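/- Let $k$ be a field, let $e\ge 4$ be an integer, and let $S_1=\langle e,e+2,e+3,\dots,2e-1\rangle$. Let $R=k[X_i : 0\le i\le e-1,\ i\ne 1]$, let $\mathfrak m$ be the ideal of $R$ generated by the variables, and let $I\subset R$ be the defining ideal of $S_1$, that is, the kernel of the $k$-algebra map $R\to k[S_1]$, $X_i\mapsto t^{e+i}$. Put $X_e=X_0^2$ and $$A_1=\begin{bmatrix}X_2&X_3&\cdots&X_{e-1}\\ X_3&X_4&\cdots&X_e\end{bmatrix}.$$ Let $F=\bigoplus_{i=2}^{e-1}Rf_i$ and $G=Rg_1\oplus Rg_2$ be free modules, and let $\phi:F\to G$ be given by $A_1$, so $\phi(f_i)=X_ig_1+X_{i+1}g_2$. Let $\mathbf E$ be the Eagon–Northcott complex of $\phi$, with $E_0=R$ and $E_i=\wedge^{i+1}F\otimes D_{i-1}G^*$ for $1\le i\le e-3$ ($D$ denoting divided powers). Let $\mathbf E^*=\operatorname{Hom}_R(\mathbf E,R)$ be its dual, indexed as a chain complex so that $\mathbf E^*_j=(E_{e-3-j})^*$. After the identification $\wedge^{e-2}F^*\cong R$, the module $\mathbf E^*_0=(D_{e-4}G^*)^*$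 (the module written $D_{e-4}G$) is free on the basis $g_1^jg_2^{e-4-j}$, $0\le j\le e-4$, dual to the divided-power basis of $D_{e-4}G^*$. Define $$\psi:\mathbf E^*_0\to R=E_0,\qquad \psi(g_1^jg_2^{e-4-j})=(-1)^j\,(X_0X_{j+4}-X_2X_{j+2}),\quad 0\le j\le e-4.$$ Then: 1. $\psi$ extends to a map of complexes $\Psi:\mathbf E^*\to\mathbf E$, i.e. there is a map of complexes $\Psi$ with $\Psi_0=\psi$. 2. For every such extension $\Psi$, the mapping cone of $\Psi$ is a minimal free resolution of $R/I$ over $R$: its modules are finite free, its homology is $R/I$ in degree $0$ and zero in all other degrees, and each of its differentials has image in $\mathfrak m$ times its target. 3. Consequently, the Betti numbers $\beta_t=\dim_k\operatorname{Tor}^R_t(k,R/I)$ of $k[S_1]\cong R/I$ are $$\beta_t=\frac{et}{e-t-1}\binom{e-2}{t+1}\quad (1\le t\le e-3),\qquad \beta_{e-2}=1.$$ -/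

import Mathlib

open CategoryTheory

universe u

noncomputable section

/-! ### Complexes of finite free modules with chosen bases -/

section Based

variable {R : Type u} [CommRing R] {α : Type}

/-- The chain complex of free `R`-modules whose `i`-th module is free on the finite set `B i` and
whose differential from degree `i + 1` to degree `i` has the matrix entries `D i p q`,
for `p ∈ B i` (rows) and `q ∈ B (i + 1)` (columns). -/
def basedComplex [DecidableEq α] (B : ℕ → Finset α) (D : ℕ → α → α → R)
    (h : ∀ i, ∀ p ∈ B i, ∀ r ∈ B (i + 2), ∑ q ∈ B (i + 1), D i p q * D (i + 1) q r = 0) :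
    ChainComplex (ModuleCat.{u} R) ℕ :=
  ChainComplex.of (fun i => ModuleCat.of R (B i → R))
    (fun i => ModuleCat.ofHom
      (Matrix.toLin' (Matrix.of fun (p : B i) (q : B (i + 1)) => D i p q)))
    (by
      intro i
      rw [← ModuleCat.ofHom_comp, ← Matrix.toLin'_mul]
      have : (Matrix.of fun (p : B i) (q : B (i + 1)) => D i p q) *
          (Matrix.of fun (p : B (i + 1)) (q : B (i + 1 + 1)) => D (i + 1) p q) = 0 := by
        ext p r
        rw [Matrix.mul_apply]
        simp only [Matrix.of_apply, Matrix.zero_apply]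
        rw [← h i p p.2 r r.2]
        exact Finset.sum_coe_sort (B (i + 1)) (fun q => D i p q * D (i + 1) q r)
      rw [this, map_zero]
      rfl)

/-- Bases of the dual of a complex of length `N`: degree `j` of the dual is the dual of degree
`N - j`, with the dual basis. -/
def dualBasis (N : ℕ) (B : ℕ → Finset α) (j : ℕ) : Finset α :=
  if j ≤ N then B (N - j) else ∅

/-- Matrix entries of the dual complex: the transposed matrices. The map from degree `j + 1` to
degree `j` is the transpose of the differential from degree `N - j` to degree `N - (j + 1)`. -/
def dualEntry (N : ℕ) (D : ℕ → α → α → R) (j : ℕ) (p q : α) : R :=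
  D (N - (j + 1)) q p

theorem dualEntry_comp (N : ℕ) (B : ℕ → Finset α) (D : ℕ → α → α → R)
    (h : ∀ i, ∀ p ∈ B i, ∀ r ∈ B (i + 2), ∑ q ∈ B (i + 1), D i p q * D (i + 1) q r = 0)
    (j : ℕ) (p : α) (hp : p ∈ dualBasis N B j) (r : α) (hr : r ∈ dualBasis N B (j + 2)) :
    ∑ q ∈ dualBasis N B (j + 1), dualEntry N D j p q * dualEntry N D (j + 1) q r = 0 := by
  unfold dualBasis at *
  by_cases hj : j + 2 ≤ N
  · obtain ⟨i, rfl⟩ := Nat.exists_eq_add_of_le hj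
    have e0 : j + 2 + i - j = i + 2 := by omega
    have e1 : j + 2 + i - (j + 1) = i + 1 := by omega
    have e2 : j + 2 + i - (j + 2) = i := by omega
    have e3 : j + 2 + i - (j + 1 + 1) = i := by omega
    rw [if_pos (by omega), e0] at hp
    rw [if_pos (by omega), e2] at hr
    rw [if_pos (by omega), e1]
    unfold dualEntry
    rw [e1, e3, ← h i r hr p hp]
    exact Finset.sum_congr rfl fun q _ => mul_comm _ _
  · rw [if_neg hj] at hr
    simp at hr

end Based

/-! ### The Eagon–Northcott complex of a `2 × n` matrix -/

section EagonNorthcott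

variable {R : Type u} [CommRing R] {n : ℕ}

/-- Bases of the modules `E 0 = R` and `E i = ⋀^(i+1) F ⊗ D_(i-1) G*` (`i ≥ 1`), where `F` is free
with basis `f_s` (`s : Fin n`) and `G` is free with basis `g₁, g₂`. For `i ≥ 1` the pair `(S, a)`
stands for `f_S ⊗ γ₁^(a) γ₂^(i-1-a)`, where `f_S` is the wedge product of the `f_s`, `s ∈ S`, in
increasing order, `γ₁, γ₂` is the basis of `G*` dual to `g₁, g₂`, and `γ^(a)` are the divided
powers. The only basis element in degree `0` is `(∅, 0)`. -/
def enBasis (n i : ℕ) : Finset (Finset (Fin n) × ℕ) :=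
  if i = 0 then {(∅, 0)} else (Finset.univ.powersetCard (i + 1)) ×ˢ Finset.range i

/-- The sign with which `f_s` contracts out of `f_S`. -/
def koszulSign (R : Type u) [CommRing R] (S : Finset (Fin n)) (s : Fin n) : R :=
  (-1) ^ (S.filter (· < s)).card

/-- Matrix entries of the Eagon–Northcott differential from degree `i + 1` to degree `i`.
For `i = 0` it sends `f_s ∧ f_t` (`s < t`) to the minor of the columns `s, t`. For `i ≥ 1` it sends
`f_S ⊗ γ₁^(b) γ₂^(c)` to the sum over `s ∈ S` of `± f_(S \ s)` tensor
`A 0 s • γ₁^(b-1) γ₂^(c) + A 1 s • γ₁^(b) γ₂^(c-1)`. -/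
def enEntry (A : Matrix (Fin 2) (Fin n) R) (i : ℕ) (p q : Finset (Fin n) × ℕ) : R :=
  if i = 0 then
    ∑ s ∈ q.1, ∑ t ∈ q.1, if s < t then A 0 s * A 1 t - A 0 t * A 1 s else 0
  else
    ∑ s ∈ q.1, if q.1.erase s = p.1 then
      koszulSign R q.1 s *
        ((if q.2 = p.2 + 1 then A 0 s else 0) + (if q.2 = p.2 then A 1 s else 0))
      else 0

theorem koszulSign_swap_aux (S : Finset (Fin n)) {s t : Fin n} (hs : s ∈ S) (hst : s < t) :
    koszulSign R S s * koszulSign R (S.erase s) t +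
      koszulSign R S t * koszulSign R (S.erase t) s = 0 := by
  unfold koszulSign
  have h1 : (S.erase t).filter (· < s) = S.filter (· < s) := by
    ext x
    simp only [Finset.mem_filter, Finset.mem_erase]
    constructor
    · rintro ⟨⟨_, h⟩, h'⟩
      exact ⟨h, h'⟩
    · rintro ⟨h, h'⟩
      exact ⟨⟨(h'.trans hst).ne, h⟩, h'⟩
  have h2 : (S.erase s).filter (· < t) = (S.filter (· < t)).erase s := by
    ext x
    simp only [Finset.mem_filter, Finset.mem_erase]
    tauto
  have h3 : s ∈ S.filter (· < t) := by simp [hs, hst]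
  rw [h1, h2]
  have h4 := Finset.card_erase_add_one h3
  rw [← h4, pow_succ]
  ring

theorem koszulSign_swap (S : Finset (Fin n)) {s t : Fin n} (hs : s ∈ S) (ht : t ∈ S)
    (hst : s ≠ t) :
    koszulSign R S s * koszulSign R (S.erase s) t +
      koszulSign R S t * koszulSign R (S.erase t) s = 0 := by
  rcases lt_or_gt_of_ne hst with h | h
  · exact koszulSign_swap_aux S hs h
  · rw [add_comm]
    exact koszulSign_swap_aux S ht h

theorem enEntry_collapse (A : Matrix (Fin 2) (Fin n) R) (i : ℕ)
    (f : Finset (Fin n) → ℕ → R) (r : Finset (Fin n) × ℕ) (hr : r ∈ enBasis n (i + 2)) :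
    ∑ q ∈ enBasis n (i + 1), f q.1 q.2 * enEntry A (i + 1) q r =
      ∑ s ∈ r.1, koszulSign R r.1 s * ∑ a ∈ Finset.range (i + 1), f (r.1.erase s) a *
        ((if r.2 = a + 1 then A 0 s else 0) + (if r.2 = a then A 1 s else 0)) := by
  have hr1 : r.1.card = i + 3 := by
    simp only [enBasis, Nat.add_eq_zero_iff, OfNat.ofNat_ne_zero, and_false, if_false,
      Finset.mem_product, Finset.mem_powersetCard] at hr
    omega
  unfold enBasis enEntry
  rw [if_neg (Nat.succ_ne_zero i), Finset.sum_product]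
  simp only [if_neg (Nat.succ_ne_zero i), Finset.mul_sum]
  rw [Finset.sum_comm]
  simp only [Finset.sum_comm (s := Finset.univ.powersetCard (i + 1 + 1))]
  rw [Finset.sum_comm]
  refine Finset.sum_congr rfl fun s hs => Finset.sum_congr rfl fun a _ => ?_
  rw [Finset.sum_eq_single (r.1.erase s)]
  · rw [if_pos rfl]
    ring
  · intro T _ hT
    rw [if_neg (Ne.symm hT), mul_zero]
  · intro h
    exact absurd (Finset.mem_powersetCard.2 ⟨Finset.subset_univ _, by
      rw [Finset.card_erase_of_mem hs]; omega⟩) h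

theorem enEntry_comp (A : Matrix (Fin 2) (Fin n) R) (i : ℕ) (p : Finset (Fin n) × ℕ)
    (hp : p ∈ enBasis n i) (r : Finset (Fin n) × ℕ) (hr : r ∈ enBasis n (i + 2)) :
    ∑ q ∈ enBasis n (i + 1), enEntry A i p q * enEntry A (i + 1) q r = 0 := by
  rw [enEntry_collapse A i (fun T a => enEntry A i p (T, a)) r hr]
  obtain ⟨S, b⟩ := r
  have hS : S.card = i + 3 ∧ b < i + 2 := by
    simpa [enBasis] using hr
  rcases Nat.eq_zero_or_pos i with rfl | hi
  · obtain ⟨hS, hb⟩ := hS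
    obtain ⟨x, y, z, hxy, hyz, rfl⟩ : ∃ x y z : Fin n, x < y ∧ y < z ∧ S = {x, y, z} := by
      refine ⟨S.orderEmbOfFin hS 0, S.orderEmbOfFin hS 1, S.orderEmbOfFin hS 2,
        (S.orderEmbOfFin hS).strictMono (by decide),
        (S.orderEmbOfFin hS).strictMono (by decide), ?_⟩
      have h := Finset.image_orderEmbOfFin_univ S hS
      refine h.symm.trans ?_
      have hu : (Finset.univ : Finset (Fin (0 + 3))) = {0, 1, 2} := by decide
      rw [hu, Finset.image_insert, Finset.image_insert, Finset.image_singleton]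
    have hxz := hxy.trans hyz
    have n1 := hxy.ne
    have n2 := hyz.ne
    have n3 := hxz.ne
    have e1 : ({x, y, z} : Finset (Fin n)).erase x = {y, z} := by ext w; simp; grind
    have e2 : ({x, y, z} : Finset (Fin n)).erase y = {x, z} := by ext w; simp; grind
    have e3 : ({x, y, z} : Finset (Fin n)).erase z = {x, y} := by ext w; simp; grind
    have s1 : ({x, y, z} : Finset (Fin n)).filter (· < x) = ∅ := by ext w; simp; grind
    have s2 : ({x, y, z} : Finset (Fin n)).filter (· < y) = {x} := by ext w; simp; grind
    have s3 : ({x, y, z} : Finset (Fin n)).filter (· < z) = {x, y} := by ext w; simp; grind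
    have hb' : b = 0 ∨ b = 1 := by omega
    have m1 : x ∉ ({y, z} : Finset (Fin n)) := by simp [n1, n3]
    have m2 : y ∉ ({z} : Finset (Fin n)) := by simp [n2]
    rw [Finset.sum_insert m1, Finset.sum_insert m2, Finset.sum_singleton]
    simp only [e1, e2, e3, koszulSign, s1, s2, s3, enEntry, if_true, zero_add, Finset.sum_range_one,
      Finset.sum_pair n1, Finset.sum_pair n2, Finset.sum_pair n3, Finset.card_pair n1,
      Finset.card_empty, Finset.card_singleton, lt_irrefl, if_false, hxy, hyz, hxz,
      hxy.not_gt, hyz.not_gt, hxz.not_gt]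
    rcases hb' with rfl | rfl <;> simp <;> ring
  · have hp2 : p.2 < i := by
      have := hp
      simp only [enBasis, if_neg hi.ne', Finset.mem_product, Finset.mem_range] at this
      exact this.2
    simp only [enEntry, if_neg hi.ne']
    have key : ∀ s ∈ S, koszulSign R S s * ∑ a ∈ Finset.range (i + 1),
          (∑ t ∈ S.erase s, if (S.erase s).erase t = p.1 then
            koszulSign R (S.erase s) t *
              ((if a = p.2 + 1 then A 0 t else 0) + (if a = p.2 then A 1 t else 0)) else 0) *
          ((if b = a + 1 then A 0 s else 0) + (if b = a then A 1 s else 0)) =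
        ∑ t ∈ S.erase s, if (S.erase s).erase t = p.1 then
          koszulSign R S s * koszulSign R (S.erase s) t *
            ((if b = p.2 + 2 then A 0 t * A 0 s else 0) +
              (if b = p.2 + 1 then A 0 t * A 1 s + A 1 t * A 0 s else 0) +
              (if b = p.2 then A 1 t * A 1 s else 0)) else 0 := by
      intro s _
      simp only [Finset.sum_mul, Finset.mul_sum]
      rw [Finset.sum_comm]
      refine Finset.sum_congr rfl fun t _ => ?_
      by_cases hU : (S.erase s).erase t = p.1
      · simp only [if_pos hU]
        have hsub : ({p.2, p.2 + 1} : Finset ℕ) ⊆ Finset.range (i + 1) := by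
          intro w hw
          simp at hw ⊢
          omega
        rw [← Finset.sum_subset hsub, Finset.sum_pair (by omega)]
        · simp only [if_true, Nat.succ_ne_self, (Nat.succ_ne_self _).symm, if_false]
          have c2 : (p.2 + 1 = p.2) = False := by simp
          simp only [zero_add, add_zero, add_assoc, Nat.reduceAdd]
          by_cases b0 : b = p.2
          · subst b0; simp; ring
          · by_cases b1 : b = p.2 + 1
            · subst b1; simp; ring
            · by_cases b2 : b = p.2 + 2
              · subst b2; simp; ring
              · simp [b0, b1, b2]
        · intro w _ hw
          simp at hw
          simp [hw.1, hw.2]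
      · simp [hU]
    rw [Finset.sum_congr rfl key, Finset.sum_sigma']
    refine Finset.sum_involution (fun x _ => ⟨x.2, x.1⟩) ?_ ?_ ?_ ?_
    · rintro ⟨s, t⟩ h
      simp only [Finset.mem_sigma, Finset.mem_erase] at h
      obtain ⟨hs, hts, ht⟩ := h
      dsimp only
      rw [Finset.erase_right_comm (s := S) (a := s) (b := t)]
      have := koszulSign_swap (R := R) S hs ht hts.symm
      by_cases hU : (S.erase t).erase s = p.1
      · simp only [if_pos hU]
        rw [mul_comm (A 0 s) (A 0 t), mul_comm (A 1 s) (A 1 t),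
          show A 0 s * A 1 t + A 1 s * A 0 t = A 0 t * A 1 s + A 1 t * A 0 s by ring,
          ← add_mul, this, zero_mul]
      · simp [hU]
    · rintro ⟨s, t⟩ h _ heq
      simp only [Finset.mem_sigma, Finset.mem_erase] at h
      simp only [Sigma.mk.injEq] at heq
      exact h.2.1 heq.1
    · rintro ⟨s, t⟩ h
      simp only [Finset.mem_sigma, Finset.mem_erase] at h ⊢
      exact ⟨h.2.2, h.2.1.symm, h.1⟩
    · rintro ⟨s, t⟩ h
      rfl

/-- The Eagon–Northcott complex of the map `Rⁿ → R²` with matrix `A`. -/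
def eagonNorthcott (A : Matrix (Fin 2) (Fin n) R) : ChainComplex (ModuleCat.{u} R) ℕ :=
  basedComplex (enBasis n) (enEntry A) (enEntry_comp A)

/-- The dual `Hom(E, R)` of the Eagon–Northcott complex `E` (of length `n - 1`), indexed as a chain
complex: degree `j` is the dual of `E (n - 1 - j)`. Its basis is the dual basis: the dual of
`f_S ⊗ γ₁^(a) γ₂^(c)` is `f_S* ⊗ g₁^a g₂^c`. -/
def eagonNorthcottDual (A : Matrix (Fin 2) (Fin n) R) : ChainComplex (ModuleCat.{u} R) ℕ :=
  basedComplex (dualBasis (n - 1) (enBasis n)) (dualEntry (n - 1) (enEntry A))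
    (dualEntry_comp (n - 1) (enBasis n) (enEntry A) (enEntry_comp A))

end EagonNorthcott

/-! ### Minimal free resolutions and Betti numbers -/

/-- `C` is a minimal free resolution of `M` with respect to the ideal `m`: its modules are finite
free, its homology is `M` in degree `0` and zero elsewhere, and each differential has its image
in `m` times its target. -/
structure IsMinimalFreeResolution {R : Type u} [CommRing R] (m : Ideal R)
    (C : ChainComplex (ModuleCat.{u} R) ℕ) (M : ModuleCat.{u} R) : Prop where
  free : ∀ i, Module.Free R (C.X i)
  finite : ∀ i, Module.Finite R (C.X i)
  exactAt : ∀ i, 0 < i → C.ExactAt i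
  homology_zero : Nonempty (C.homology 0 ≅ M)
  minimal : ∀ i, LinearMap.range (C.d (i + 1) i).hom ≤ m • (⊤ : Submodule R (C.X i))

/-- The `t`-th Betti number of a module `M` over the polynomial ring `k[X_i : i ∈ σ]`: the
`k`-dimension of `Tor_t(k, M)`, where `k` is the quotient by the ideal of the variables. -/
def bettiNumber (k : Type u) [Field k] (σ : Type) (M : ModuleCat.{u} (MvPolynomial σ k)) (t : ℕ) :
    ℕ :=
  Module.finrank k ((ModuleCat.restrictScalars (algebraMap k (MvPolynomial σ k))).obj
    (((Tor (ModuleCat.{u} (MvPolynomial σ k)) t).obj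
      (ModuleCat.of _ (MvPolynomial σ k ⧸ MvPolynomial.idealOfVars σ k))).obj M))

/-! ### The semigroup `⟨e, e+2, …, 2e-1⟩` -/

/-- The index set `{0, …, e-1} \ {1}`. -/
abbrev SallyIdx (e : ℕ) : Type := {i : ℕ // i < e ∧ i ≠ 1}

/-- The numerical semigroup generated by `e + i`, `i ∈ {0, …, e-1} \ {1}`. -/
def sallySemigroup (e : ℕ) : AddSubmonoid ℕ :=
  AddSubmonoid.closure (Set.range fun i : SallyIdx e => e + (i : ℕ))

/-- The polynomial ring in the variables `X_i`, `i ∈ {0, …, e-1} \ {1}`. -/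
abbrev SallyRing (k : Type u) [Field k] (e : ℕ) : Type u := MvPolynomial (SallyIdx e) k

/-- The map from the polynomial ring to the semigroup ring sending `X_i` to `t^(e+i)`. -/
def sallyMap (k : Type u) [Field k] (e : ℕ) :
    SallyRing k e →ₐ[k] AddMonoidAlgebra k (sallySemigroup e) :=
  MvPolynomial.aeval fun i =>
    AddMonoidAlgebra.single ⟨e + (i : ℕ), AddSubmonoid.subset_closure ⟨i, rfl⟩⟩ 1

/-- The defining ideal of the semigroup. -/
def sallyIdeal (k : Type u) [Field k] (e : ℕ) : Ideal (SallyRing k e) :=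
  RingHom.ker (sallyMap k e)

/-- The variable `X_i`, extended by `X_e = X_0²` (and by `0` at the unused indices). -/
def sallyX (k : Type u) [Field k] (e i : ℕ) : SallyRing k e :=
  if h : i < e ∧ i ≠ 1 then MvPolynomial.X ⟨i, h⟩
  else if h : i = e ∧ 0 < e then MvPolynomial.X ⟨0, h.2, by decide⟩ ^ 2
  else 0

/-- The `2 × (e-2)` matrix with rows `X_2, …, X_(e-1)` and `X_3, …, X_e`. -/
def sallyMatrix (k : Type u) [Field k] (e : ℕ) : Matrix (Fin 2) (Fin (e - 2)) (SallyRing k e) :=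
  Matrix.of fun r c => sallyX k e (r + c + 2)

/-- The map from degree `0` of the dual complex, with basis `g₁^j g₂^(e-4-j)`, to degree `0` of the
Eagon–Northcott complex, which is `R`, sending `g₁^j g₂^(e-4-j)` to
`(-1)^j (X_0 X_(j+4) - X_2 X_(j+2))`. -/
def sallyPsi (k : Type u) [Field k] (e : ℕ) :
    (eagonNorthcottDual (sallyMatrix k e)).X 0 ⟶ (eagonNorthcott (sallyMatrix k e)).X 0 :=
  ModuleCat.ofHom (Matrix.toLin' (Matrix.of
    fun (_ : enBasis (e - 2) 0) (q : dualBasis (e - 2 - 1) (enBasis (e - 2)) 0) =>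
      (-1) ^ q.1.2 *
        (sallyX k e 0 * sallyX k e (q.1.2 + 4) - sallyX k e 2 * sallyX k e (q.1.2 + 2))))

end

/-!
The defining ideal of `S₁` is the sum of the ideal `I₂` of maximal minors of `A₁` and the ideal
generated by the values of `ψ`. One inclusion is a computation. For the other, the relations
`X_i X_j = X_a X_b` (`i + j = a + b`, from the minors) and those from `ψ` rewrite every monomial as
a power of `X_0` times `1`, a variable, or `X_2 X_{e-1}` (`sallyIdeal_eq`); these normal forms have
distinct degrees in `k[t]`, so they are linearly independent modulo the kernel.

The Eagon–Northcott complex `E` and its dual are exact in positive degrees by the following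
criterion (`exact_mod_of_nullHomotopic`): a complex of finite free modules of length `N` is exact in
positive degrees if multiplication by each member of some regular sequence of length `N` is
null-homotopic on it. Multiplication by a maximal minor is null-homotopic on `E`
(`nullHomotopic_minor`), hence also on the dual. The ideal of minors contains the `e - 3` elements
`X_i² - X_{i-1} X_{i+1}`, `3 ≤ i ≤ e - 1`, and they form a regular sequence because for a suitable
weight their leading monomials are the squares `X_i²` (`hasLeadingMonomial_sallySeq`,
`mem_span_of_mul_mem`).

This sequence remains regular after prepending `X_2` or `X_2² - X_0 X_4`, so `X_2` is a
nonzerodivisor on the zeroth homology of `E*` and `ψ(g_2^{e-4}) = X_0 X_4 - X_2²` is one on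
`R ⧸ I₂`. After inverting `X_2`, the zeroth homology of `E*` is generated by the class of
`g_2^{e-4}`. Therefore `ψ` induces an injective map from it to `R ⧸ I₂`
(`mem_boundaries_of_psi_mem`), so the cone is exact in positive degrees and has zeroth homology
`R ⧸ I`.

For minimality, write `ψ = X_0 α - X_2 β` with `α`, `β` given by the coefficients `(-1)^j X_{j+4}`
and `(-1)^j X_{j+2}`. Both are compatible with the relations of `E*` modulo `I₂`, so they extend to
chain maps, and the corresponding combination of these is an extension of `ψ` that vanishes modulo
the variables (`exists_chainMap_sallyPsi`). Two extensions of `ψ` are homotopic and the differentials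
of `E` and `E*` vanish modulo the variables, so every extension does. The Betti numbers are then the
ranks of the modules in the cone.
-/

noncomputable section


/-! ### Based complexes: exactness from null-homotopies and regular sequences -/

section BasedExactness

variable {R : Type u} [CommRing R] {α : Type}

/-- The linear map with matrix entries `M p q`, with columns `q` ranging over the finite set `B`.
Vectors are functions on all of `α`; only their values on the relevant finite set matter. -/
def actOn (B : Finset α) (M : α → α → R) : (α → R) →ₗ[R] (α → R) where
  toFun z p := ∑ q ∈ B, M p q * z q
  map_add' z w := by
    funext p
    simp only [Pi.add_apply, mul_add, Finset.sum_add_distrib]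
  map_smul' c z := by
    funext p
    simp only [Pi.smul_apply, smul_eq_mul, RingHom.id_apply, Finset.mul_sum, mul_left_comm]

theorem actOn_apply (B : Finset α) (M : α → α → R) (z : α → R) (p : α) :
    actOn B M z p = ∑ q ∈ B, M p q * z q := rfl

theorem actOn_congr {B : Finset α} (M : α → α → R) {z w : α → R} (h : ∀ q ∈ B, z q = w q) :
    actOn B M z = actOn B M w := by
  funext p
  exact Finset.sum_congr rfl fun q hq => by rw [h q hq]

theorem actOn_mem {B : Finset α} (M : α → α → R) {z : α → R} {J : Ideal R}
    (h : ∀ q ∈ B, z q ∈ J) (p : α) : actOn B M z p ∈ J :=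
  J.sum_mem fun q hq => J.mul_mem_left _ (h q hq)

theorem actOn_actOn (B B' : Finset α) (M M' : α → α → R) (z : α → R) (p : α) :
    actOn B M (actOn B' M' z) p = ∑ q ∈ B', (∑ r ∈ B, M p r * M' r q) * z q := by
  simp only [actOn_apply, Finset.mul_sum, Finset.sum_mul, mul_assoc]
  exact Finset.sum_comm

/-- The sequence of matrices `D i` (rows in `B i`, columns in `B (i + 1)`) composes to zero. -/
def IsBasedComplex (B : ℕ → Finset α) (D : ℕ → α → α → R) : Prop :=
  ∀ i, ∀ p ∈ B i, ∀ r ∈ B (i + 2), ∑ q ∈ B (i + 1), D i p q * D (i + 1) q r = 0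

theorem IsBasedComplex.actOn_actOn_eq_zero {B : ℕ → Finset α} {D : ℕ → α → α → R}
    (h : IsBasedComplex B D) (i : ℕ) (z : α → R) {p : α} (hp : p ∈ B i) :
    actOn (B (i + 1)) (D i) (actOn (B (i + 2)) (D (i + 1)) z) p = 0 := by
  rw [actOn_actOn]
  exact Finset.sum_eq_zero fun q hq => by rw [h i p hp q hq, zero_mul]

/-- Multiplication by `x` on the based complex with differentials `D` is null-homotopic. -/
def NullHomotopic [DecidableEq α] (B : ℕ → Finset α) (D : ℕ → α → α → R) (x : R) : Prop :=
  ∃ H : ℕ → α → α → R,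
    (∀ p ∈ B 0, ∀ q ∈ B 0, ∑ r ∈ B 1, D 0 p r * H 0 r q = if p = q then x else 0) ∧
    ∀ i, ∀ p ∈ B (i + 1), ∀ q ∈ B (i + 1),
      ∑ r ∈ B (i + 2), D (i + 1) p r * H (i + 1) r q + ∑ r ∈ B i, H i p r * D i r q =
        if p = q then x else 0

section Homotopy

variable [DecidableEq α] {B : ℕ → Finset α} {D : ℕ → α → α → R}

theorem NullHomotopic.zero : NullHomotopic B D (0 : R) :=
  ⟨fun _ _ _ => 0, by simp, by simp⟩

theorem NullHomotopic.add {x y : R} (hx : NullHomotopic B D x) (hy : NullHomotopic B D y) :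
    NullHomotopic B D (x + y) := by
  obtain ⟨H, h0, h1⟩ := hx
  obtain ⟨K, k0, k1⟩ := hy
  refine ⟨fun i p q => H i p q + K i p q, fun p hp q hq => ?_, fun i p hp q hq => ?_⟩
  · simp only [mul_add, Finset.sum_add_distrib, h0 p hp q hq, k0 p hp q hq]
    split_ifs <;> simp
  · simp only [mul_add, add_mul, Finset.sum_add_distrib]
    rw [add_add_add_comm, h1 i p hp q hq, k1 i p hp q hq]
    split_ifs <;> simp

theorem NullHomotopic.mul_left (c : R) {x : R} (hx : NullHomotopic B D x) :
    NullHomotopic B D (c * x) := by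
  obtain ⟨H, h0, h1⟩ := hx
  refine ⟨fun i p q => c * H i p q, fun p hp q hq => ?_, fun i p hp q hq => ?_⟩
  · simp only [mul_left_comm _ c, ← Finset.mul_sum, h0 p hp q hq, mul_ite, mul_zero]
  · simp only [mul_left_comm _ c, mul_assoc, ← Finset.mul_sum]
    rw [← mul_add, h1 i p hp q hq, mul_ite, mul_zero]

/-- The transposed homotopy: a null-homotopic multiplication on a complex of length `N` is
null-homotopic on its dual. -/
theorem NullHomotopic.dual {N : ℕ} (hN : 0 < N) (hB : B (N + 1) = ∅) {x : R}
    (hx : NullHomotopic B D x) : NullHomotopic (dualBasis N B) (dualEntry N D) x := by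
  obtain ⟨H, h0, h1⟩ := hx
  refine ⟨fun j p q => H (N - (j + 1)) q p, fun p hp q hq => ?_, fun j p hp q hq => ?_⟩
  · obtain ⟨M, rfl⟩ : ∃ M, N = M + 1 := ⟨N - 1, by omega⟩
    have := h1 M q (by simpa [dualBasis] using hq) p (by simpa [dualBasis] using hp)
    rw [hB, Finset.sum_empty, zero_add] at this
    simp only [dualBasis, dualEntry, Nat.le_add_left, if_true, Nat.add_sub_cancel, zero_add]
    simp only [eq_comm (a := p)]
    rw [← this]
    exact Finset.sum_congr rfl fun r _ => mul_comm _ _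
  · unfold dualBasis at *
    by_cases hj : j + 1 ≤ N
    · obtain ⟨i, rfl⟩ := Nat.exists_eq_add_of_le hj
      have e1 : j + 1 + i - (j + 1) = i := by omega
      have e0 : j + 1 + i - j = i + 1 := by omega
      have e2 : j + 1 + i - (j + 1 + 1) = i - 1 := by omega
      rw [if_pos hj, e1] at hp hq
      rw [if_pos (by omega : j ≤ j + 1 + i), e0]
      simp only [dualEntry, e1, e2]
      simp only [eq_comm (a := p)]
      rcases i with _ | i
      · rw [if_neg (by omega), Finset.sum_empty, zero_add, ← h0 q hq p hp]
        exact Finset.sum_congr rfl fun r _ => mul_comm _ _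
      · rw [if_pos (by omega), ← h1 i q hq p hp, add_comm]
        congr 1
        · exact Finset.sum_congr rfl fun r _ => mul_comm _ _
        · exact Finset.sum_congr rfl fun r _ => mul_comm _ _
    · rw [if_neg hj] at hp
      simp at hp

/-- **Acyclicity lemma.** If a based complex of length `N` has null-homotopic multiplications by
`y 0, …, y (N - 1)`, and these elements form a regular sequence modulo `J 0`, then the complex is
exact in positive degrees modulo `J 0`. Exactness modulo `J q` in degree `i` follows from exactness
modulo `J (q + 1) = J q + (y q)` in degree `i + 1`, because a cycle `z` satisfies
`y q • z = d (s z)` for the homotopy `s`. -/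
theorem exact_mod_of_nullHomotopic (hD : IsBasedComplex B D) {N : ℕ}
    (hB : ∀ i, N < i → B i = ∅) (y : ℕ → R) (J : ℕ → Ideal R)
    (hJ : ∀ q, J (q + 1) = J q ⊔ Ideal.span {y q})
    (reg : ∀ q < N, ∀ z, y q * z ∈ J q → z ∈ J q)
    (hom : ∀ q < N, NullHomotopic B D (y q)) (i : ℕ) (z : α → R)
    (hz : ∀ p ∈ B i, actOn (B (i + 1)) (D i) z p ∈ J 0) :
    ∃ v, ∀ p ∈ B (i + 1), z p - actOn (B (i + 2)) (D (i + 1)) v p ∈ J 0 := by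
  suffices H : ∀ m q, q + m = N → ∀ i, q ≤ i → ∀ z : α → R,
      (∀ p ∈ B i, actOn (B (i + 1)) (D i) z p ∈ J q) →
      ∃ v, ∀ p ∈ B (i + 1), z p - actOn (B (i + 2)) (D (i + 1)) v p ∈ J q from
    H N 0 (zero_add N) i (Nat.zero_le i) z hz
  intro m
  induction m with
  | zero =>
    intro q hq i hi z _
    refine ⟨0, fun p hp => ?_⟩
    rw [hB (i + 1) (by omega)] at hp
    simp at hp
  | succ m ih =>
    intro q hq i hi z hz
    obtain ⟨H, -, h1⟩ := hom q (by omega)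
    have key : ∀ p ∈ B (i + 1), actOn (B (i + 2)) (D (i + 1)) (actOn (B (i + 1)) (H (i + 1)) z) p
        + actOn (B i) (H i) (actOn (B (i + 1)) (D i) z) p = y q * z p := by
      intro p hp
      rw [actOn_actOn, actOn_actOn, ← Finset.sum_add_distrib]
      simp only [← add_mul]
      rw [Finset.sum_congr rfl fun r hr => by rw [h1 i p hp r hr]]
      simp [hp]
    have hsub : J q ≤ J (q + 1) := by rw [hJ]; exact le_sup_left
    have hy : y q ∈ J (q + 1) := by
      rw [hJ]; exact Ideal.mem_sup_right (Ideal.mem_span_singleton_self _)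
    obtain ⟨v, hv⟩ := ih (q + 1) (by omega) (i + 1) (by omega)
      (actOn (B (i + 1)) (H (i + 1)) z) (fun p hp => by
        rw [eq_sub_of_add_eq (key p hp)]
        exact Ideal.sub_mem _ (Ideal.mul_mem_right _ _ hy) (hsub (actOn_mem _ hz p)))
    have hdec : ∀ p, ∃ b, p ∈ B (i + 2) →
        actOn (B (i + 1)) (H (i + 1)) z p - actOn (B (i + 3)) (D (i + 2)) v p - y q * b ∈ J q := by
      intro p
      by_cases hp : p ∈ B (i + 2)
      · have := hv p hp
        rw [hJ] at this
        obtain ⟨a, ha, c, hc, hac⟩ := Submodule.mem_sup.1 this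
        obtain ⟨b, rfl⟩ := Ideal.mem_span_singleton'.1 hc
        refine ⟨b, fun _ => ?_⟩
        rw [← hac, mul_comm b, add_sub_cancel_right]
        exact ha
      · exact ⟨0, fun h => absurd h hp⟩
    choose b hb using hdec
    refine ⟨b, fun p hp => reg q (by omega) _ ?_⟩
    have h2 := actOn_mem (D (i + 1)) hb p
    have h3 : actOn (B (i + 2)) (D (i + 1)) (fun p => actOn (B (i + 1)) (H (i + 1)) z p -
        actOn (B (i + 3)) (D (i + 2)) v p - y q * b p) p =
        actOn (B (i + 2)) (D (i + 1)) (actOn (B (i + 1)) (H (i + 1)) z) p -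
          y q * actOn (B (i + 2)) (D (i + 1)) b p := by
      have : (fun p => actOn (B (i + 1)) (H (i + 1)) z p -
          actOn (B (i + 3)) (D (i + 2)) v p - y q * b p) = actOn (B (i + 1)) (H (i + 1)) z -
          actOn (B (i + 3)) (D (i + 2)) v - y q • b := rfl
      rw [this, map_sub, map_sub, map_smul, Pi.sub_apply, Pi.sub_apply,
        hD.actOn_actOn_eq_zero (i + 1) v hp, sub_zero, Pi.smul_apply, smul_eq_mul]
    rw [h3, eq_sub_of_add_eq (key p hp)] at h2
    have h4 := (J q).add_mem h2 (actOn_mem (H i) hz p)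
    convert h4 using 1
    ring

/-- The vectors agreeing on `B i` with the image of the differential from degree `i + 1`. -/
def boundaries (B : ℕ → Finset α) (D : ℕ → α → α → R) (i : ℕ) : Submodule R (α → R) where
  carrier := {z | ∃ v, ∀ p ∈ B i, z p = actOn (B (i + 1)) (D i) v p}
  add_mem' := by
    rintro z w ⟨v, hv⟩ ⟨v', hv'⟩
    exact ⟨v + v', fun p hp => by rw [map_add, Pi.add_apply, Pi.add_apply, hv p hp, hv' p hp]⟩
  zero_mem' := ⟨0, fun p _ => by rw [map_zero]⟩
  smul_mem' := by
    rintro c z ⟨v, hv⟩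
    exact ⟨c • v, fun p hp => by rw [map_smul, Pi.smul_apply, Pi.smul_apply, hv p hp]⟩

/-- If the complex is exact in degree `1` modulo `c`, and `c` is a nonzerodivisor, then `c` is a
nonzerodivisor on the zeroth homology. -/
theorem mem_boundaries_of_smul_mem (hD : IsBasedComplex B D) {c : R}
    (hc : ∀ z, c * z = 0 → z = 0)
    (hex : ∀ z : α → R, (∀ p ∈ B 0, actOn (B 1) (D 0) z p ∈ Ideal.span {c}) →
      ∃ v, ∀ p ∈ B 1, z p - actOn (B 2) (D 1) v p ∈ Ideal.span {c})
    {z : α → R} (hz : c • z ∈ boundaries B D 0) : z ∈ boundaries B D 0 := by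
  obtain ⟨u, hu⟩ := hz
  obtain ⟨v, hv⟩ := hex u fun p hp => by
    rw [← hu p hp]
    exact Ideal.mul_mem_right _ _ (Ideal.mem_span_singleton_self c)
  have hdec : ∀ p, ∃ b, p ∈ B 1 → u p - actOn (B 2) (D 1) v p = c * b := by
    intro p
    by_cases hp : p ∈ B 1
    · obtain ⟨b, hb⟩ := Ideal.mem_span_singleton.1 (hv p hp)
      exact ⟨b, fun _ => hb⟩
    · exact ⟨0, fun h => absurd h hp⟩
  choose b hb using hdec
  refine ⟨b, fun p hp => ?_⟩
  have h1 : actOn (B 1) (D 0) u p = c * actOn (B 1) (D 0) b p := by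
    have h2 : actOn (B 1) (D 0) (u - actOn (B 2) (D 1) v) = actOn (B 1) (D 0) (c • b) :=
      actOn_congr _ fun q hq => hb q hq
    have h3 := congrFun h2 p
    rwa [map_sub, map_smul, Pi.sub_apply, hD.actOn_actOn_eq_zero 0 v hp, sub_zero] at h3
  refine sub_eq_zero.1 (hc _ ?_)
  rw [mul_sub, ← h1, ← hu p hp, Pi.smul_apply, smul_eq_mul, sub_self]

/-- A null-homotopic multiplication annihilates the zeroth homology. -/
theorem NullHomotopic.smul_mem_boundaries {x : R} (hx : NullHomotopic B D x) (z : α → R) :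
    x • z ∈ boundaries B D 0 := by
  obtain ⟨H, h0, -⟩ := hx
  refine ⟨actOn (B 0) (H 0) z, fun p hp => ?_⟩
  rw [actOn_actOn, Finset.sum_congr rfl fun r hr => by rw [h0 p hp r hr]]
  simp [hp]

end Homotopy

end BasedExactness

/-! ### Exterior and contraction operators -/

section Clifford

variable {R : Type u} [CommRing R] {n : ℕ}

theorem koszulSign_mul_self (S : Finset (Fin n)) (s : Fin n) :
    koszulSign R S s * koszulSign R S s = 1 := by
  unfold koszulSign
  rw [← mul_pow]
  simp

theorem koszulSign_insert {S : Finset (Fin n)} {s : Fin n} (hs : s ∉ S) (t : Fin n) :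
    koszulSign R (insert s S) t = (if s < t then -1 else 1) * koszulSign R S t := by
  unfold koszulSign
  rw [Finset.filter_insert]
  split_ifs with h
  · rw [Finset.card_insert_of_notMem (fun h' => hs (Finset.mem_filter.1 h').1), pow_succ]
    ring
  · simp

theorem koszulSign_erase {S : Finset (Fin n)} {s : Fin n} (hs : s ∈ S) (t : Fin n) :
    koszulSign R (S.erase s) t = (if s < t then -1 else 1) * koszulSign R S t := by
  conv_rhs => rw [← Finset.insert_erase hs, koszulSign_insert (Finset.notMem_erase s S)]
  split_ifs <;> simp

/-- Exterior multiplication by `f_u` on the left; an element of `⋀ F` is given by its coordinates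
with respect to the basis `f_S`. -/
def wedgeOp (u : Fin n) : (Finset (Fin n) → R) →ₗ[R] (Finset (Fin n) → R) where
  toFun w S := if u ∈ S then koszulSign R S u * w (S.erase u) else 0
  map_add' w w' := by
    funext S
    by_cases h : u ∈ S <;> simp [h, mul_add]
  map_smul' c w := by
    funext S
    by_cases h : u ∈ S <;> simp [h, mul_left_comm]

theorem wedgeOp_apply (u : Fin n) (w : Finset (Fin n) → R) (S : Finset (Fin n)) :
    wedgeOp u w S = if u ∈ S then koszulSign R S u * w (S.erase u) else 0 := rfl

/-- Contraction with the basis vector of `F*` dual to `f_s`. -/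
def contractOp (s : Fin n) : (Finset (Fin n) → R) →ₗ[R] (Finset (Fin n) → R) where
  toFun w S := if s ∈ S then 0 else koszulSign R S s * w (insert s S)
  map_add' w w' := by
    funext S
    by_cases h : s ∈ S <;> simp [h, mul_add]
  map_smul' c w := by
    funext S
    by_cases h : s ∈ S <;> simp [h, mul_left_comm]

theorem contractOp_apply (s : Fin n) (w : Finset (Fin n) → R) (S : Finset (Fin n)) :
    contractOp s w S = if s ∈ S then 0 else koszulSign R S s * w (insert s S) := rfl

theorem contractOp_anticomm (s t : Fin n) (w : Finset (Fin n) → R) :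
    contractOp s (contractOp t w) + contractOp t (contractOp s w) = 0 := by
  funext S
  simp only [Pi.add_apply, contractOp_apply, Pi.zero_apply]
  by_cases hst : s = t
  · subst hst; simp
  by_cases hs : s ∈ S
  · simp [hs]
  by_cases ht : t ∈ S
  · simp [ht]
  simp only [hs, ht, Finset.mem_insert, hst, Ne.symm hst, if_false, or_self,
    koszulSign_insert hs, koszulSign_insert ht, Finset.insert_comm t s]
  rcases lt_or_gt_of_ne hst with h | h
  · simp only [h, h.not_gt, if_true, if_false]; ring
  · simp only [h, h.not_gt, if_true, if_false]; ring

theorem contractOp_wedgeOp (s t : Fin n) (w : Finset (Fin n) → R) :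
    contractOp s (wedgeOp t w) + wedgeOp t (contractOp s w) = if s = t then w else 0 := by
  funext S
  simp only [Pi.add_apply, contractOp_apply, wedgeOp_apply]
  by_cases hst : s = t
  · subst hst
    by_cases hs : s ∈ S
    · simp [hs, koszulSign_erase hs, ← mul_assoc, koszulSign_mul_self]
    · simp [hs, koszulSign_insert hs, ← mul_assoc, koszulSign_mul_self]
  rw [if_neg hst]
  by_cases hs : s ∈ S
  · simp [hs, hst]
  by_cases ht : t ∈ S
  · simp only [hs, ht, Finset.mem_insert, Ne.symm hst, if_false, if_true, Finset.mem_erase,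
      and_false, or_true, koszulSign_insert hs, koszulSign_erase ht,
      Finset.erase_insert_of_ne hst, Pi.zero_apply]
    rcases lt_or_gt_of_ne hst with h | h
    · simp only [h, h.not_gt, if_true, if_false]; ring
    · simp only [h, h.not_gt, if_true, if_false]; ring
  · simp [hs, ht, Ne.symm hst]

/-- Contraction with the linear form `x` on `F`. -/
def contractVec (x : Fin n → R) : (Finset (Fin n) → R) →ₗ[R] (Finset (Fin n) → R) :=
  ∑ s, x s • contractOp s

theorem contractVec_eq (x : Fin n → R) (w : Finset (Fin n) → R) :
    contractVec x w = ∑ s, x s • contractOp s w := by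
  simp [contractVec, LinearMap.sum_apply]

theorem contractVec_apply (x : Fin n → R) (w : Finset (Fin n) → R) (S : Finset (Fin n)) :
    contractVec x w S = ∑ s, x s * contractOp s w S := by
  simp [contractVec_eq, Finset.sum_apply]

theorem contractVec_anticomm (x y : Fin n → R) (w : Finset (Fin n) → R) :
    contractVec x (contractVec y w) = -contractVec y (contractVec x w) := by
  rw [eq_neg_iff_add_eq_zero]
  simp only [contractVec_eq, map_sum, map_smul, Finset.smul_sum, smul_smul]
  rw [Finset.sum_comm, ← Finset.sum_add_distrib]
  refine Finset.sum_eq_zero fun s _ => ?_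
  rw [← Finset.sum_add_distrib]
  refine Finset.sum_eq_zero fun t _ => ?_
  rw [mul_comm (y t), ← smul_add, contractOp_anticomm, smul_zero]

theorem contractVec_self (x : Fin n → R) (w : Finset (Fin n) → R) :
    contractVec x (contractVec x w) = 0 := by
  have key : ∀ s t : Fin n, contractOp s (contractOp t w) = -contractOp t (contractOp s w) :=
    fun s t => eq_neg_of_add_eq_zero_left (contractOp_anticomm s t w)
  simp only [contractVec_eq, map_sum, map_smul, Finset.smul_sum, smul_smul]
  rw [← Finset.sum_product']
  refine Finset.sum_involution (fun p _ => (p.2, p.1)) ?_ ?_ ?_ ?_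
  · rintro ⟨s, t⟩ _
    dsimp only
    rw [mul_comm (x t), ← smul_add, contractOp_anticomm, smul_zero]
  · rintro ⟨s, t⟩ _ hne heq
    have hts : t = s := congrArg Prod.fst heq
    subst hts
    refine hne ?_
    have : contractOp t (contractOp t w) = 0 := by
      funext S
      by_cases h : t ∈ S <;> simp [contractOp_apply, h]
    simp [this]
  · simp
  · simp

theorem contractVec_wedgeOp (x : Fin n → R) (t : Fin n) (w : Finset (Fin n) → R) :
    contractVec x (wedgeOp t w) = x t • w - wedgeOp t (contractVec x w) := by
  rw [eq_sub_iff_add_eq]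
  simp only [contractVec_eq, map_sum, map_smul, ← Finset.sum_add_distrib, ← smul_add,
    contractOp_wedgeOp]
  rw [Finset.sum_eq_single t]
  · simp
  · intro s _ hs
    simp [hs]
  · simp

end Clifford

/-! ### Minors act null-homotopically on the Eagon–Northcott complex -/

section MinorHomotopy

variable {R : Type u} [CommRing R] {n : ℕ}

/-- The coefficient of `γ₁^(a)` in a vector indexed by pairs `(S, a)`. -/
def slice (a : ℕ) : (Finset (Fin n) × ℕ → R) →ₗ[R] (Finset (Fin n) → R) where
  toFun z S := z (S, a)
  map_add' _ _ := rfl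
  map_smul' _ _ := rfl

/-- The differential `ι(A 0) ⊗ γ₁ + ι(A 1) ⊗ γ₂` in degrees `≥ 2`, without truncation. -/
def enDiff (A : Matrix (Fin 2) (Fin n) R) (z : Finset (Fin n) × ℕ → R) :
    Finset (Fin n) × ℕ → R :=
  fun p => contractVec (A 0) (slice (p.2 + 1) z) p.1 + contractVec (A 1) (slice p.2 z) p.1

theorem slice_enDiff (A : Matrix (Fin 2) (Fin n) R) (z : Finset (Fin n) × ℕ → R) (a : ℕ) :
    slice a (enDiff A z) = contractVec (A 0) (slice (a + 1) z) + contractVec (A 1) (slice a z) :=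
  rfl

theorem mem_enBasis_succ {i : ℕ} {p : Finset (Fin n) × ℕ} :
    p ∈ enBasis n (i + 1) ↔ p.1.card = i + 2 ∧ p.2 ≤ i := by
  simp [enBasis]

theorem enBasis_zero : enBasis n 0 = {(∅, 0)} := rfl

theorem enBasis_eq_empty {i : ℕ} (hi : n ≤ i) (h0 : 0 < i) : enBasis n i = ∅ := by
  obtain ⟨j, rfl⟩ : ∃ j, i = j + 1 := ⟨i - 1, by omega⟩
  refine Finset.eq_empty_of_forall_notMem fun p hp => ?_
  have h1 := (mem_enBasis_succ.1 hp).1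
  have h2 := Finset.card_le_univ p.1
  rw [Fintype.card_fin] at h2
  omega

theorem actOn_enEntry_succ (A : Matrix (Fin 2) (Fin n) R) (i : ℕ) (z : Finset (Fin n) × ℕ → R)
    {p : Finset (Fin n) × ℕ} (hp : p ∈ enBasis n (i + 1)) :
    actOn (enBasis n (i + 2)) (enEntry A (i + 1)) z p = enDiff A z p := by
  obtain ⟨T, a⟩ := p
  obtain ⟨hT, ha⟩ := mem_enBasis_succ.1 hp
  dsimp only at hT ha
  rw [actOn_apply, enBasis, if_neg (by omega), Finset.sum_product]
  have h1 : ∀ S : Finset (Fin n), ∑ b ∈ Finset.range (i + 2),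
      enEntry A (i + 1) (T, a) (S, b) * z (S, b) =
      ∑ s, if s ∈ S ∧ S.erase s = T then
        koszulSign R S s * (A 0 s * z (S, a + 1) + A 1 s * z (S, a)) else 0 := by
    intro S
    simp only [enEntry, Nat.succ_ne_zero, if_false, Finset.sum_mul]
    rw [Finset.sum_comm, ← Finset.sum_filter_add_sum_filter_not Finset.univ (· ∈ S)]
    rw [Finset.filter_mem_eq_inter, Finset.univ_inter,
      Finset.sum_eq_zero (s := Finset.univ.filter fun x => x ∉ S), add_zero]
    · refine Finset.sum_congr rfl fun s hs => ?_
      by_cases h : S.erase s = T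
      · simp only [h, hs, if_true, and_self, mul_add, add_mul, Finset.sum_add_distrib, mul_ite,
          mul_zero, ite_mul, zero_mul, Finset.sum_ite_eq', Finset.mem_range]
        rw [if_pos (by omega), if_pos (by omega)]
        ring
      · simp [h]
    · intro s hs
      simp [(Finset.mem_filter.1 hs).2]
  simp only [h1]
  rw [Finset.sum_comm]
  simp only [enDiff, contractVec_apply, ← Finset.sum_add_distrib]
  refine Finset.sum_congr rfl fun s _ => ?_
  by_cases hs : s ∈ T
  · simp only [contractOp_apply, hs, if_true, mul_zero, add_zero]
    refine Finset.sum_eq_zero fun S _ => if_neg ?_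
    rintro ⟨_, rfl⟩
    simp at hs
  · rw [Finset.sum_eq_single (insert s T)]
    · simp only [Finset.mem_insert_self, Finset.erase_insert hs, and_self, if_true,
        contractOp_apply, hs, if_false, koszulSign_insert hs, lt_irrefl, one_mul]
      simp only [slice, LinearMap.coe_mk, AddHom.coe_mk]
      ring
    · intro S _ hS
      refine if_neg ?_
      rintro ⟨h, rfl⟩
      exact hS (Finset.insert_erase h).symm
    · intro h
      exact absurd (Finset.mem_powersetCard.2 ⟨Finset.subset_univ _, by
        rw [Finset.card_insert_of_notMem hs, hT]⟩) h

theorem actOn_enEntry_zero (A : Matrix (Fin 2) (Fin n) R) (z : Finset (Fin n) × ℕ → R)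
    (p : Finset (Fin n) × ℕ) :
    actOn (enBasis n 1) (enEntry A 0) z p =
      -contractVec (A 0) (contractVec (A 1) (slice 0 z)) ∅ := by
  have h1 : actOn (enBasis n 1) (enEntry A 0) z p = ∑ s, ∑ t,
      if s < t then (A 0 s * A 1 t - A 0 t * A 1 s) * z ({s, t}, 0) else 0 := by
    rw [actOn_apply, enBasis, if_neg one_ne_zero, Finset.sum_product]
    simp only [Finset.sum_range_one, enEntry, if_true, Finset.sum_mul]
    have h2 : ∀ S : Finset (Fin n), ∑ s ∈ S, ∑ t ∈ S,
        (if s < t then A 0 s * A 1 t - A 0 t * A 1 s else 0) * z (S, 0) =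
        ∑ s, ∑ t, if s ∈ S ∧ t ∈ S ∧ s < t then
          (A 0 s * A 1 t - A 0 t * A 1 s) * z (S, 0) else 0 := by
      intro S
      rw [← Finset.sum_filter_add_sum_filter_not Finset.univ (· ∈ S)]
      rw [Finset.filter_mem_eq_inter, Finset.univ_inter,
        Finset.sum_eq_zero (s := Finset.univ.filter fun x => x ∉ S), add_zero]
      · refine Finset.sum_congr rfl fun s hs => ?_
        rw [← Finset.sum_filter_add_sum_filter_not Finset.univ (· ∈ S)]
        rw [Finset.filter_mem_eq_inter, Finset.univ_inter,
          Finset.sum_eq_zero (s := Finset.univ.filter fun x => x ∉ S), add_zero]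
        · refine Finset.sum_congr rfl fun t ht => ?_
          simp [hs, ht, ite_mul]
        · intro t ht
          simp [(Finset.mem_filter.1 ht).2]
      · intro s hs
        simp [(Finset.mem_filter.1 hs).2]
    simp only [h2]
    rw [Finset.sum_comm]
    refine Finset.sum_congr rfl fun s _ => ?_
    rw [Finset.sum_comm]
    refine Finset.sum_congr rfl fun t _ => ?_
    by_cases hst : s < t
    · rw [Finset.sum_eq_single {s, t}]
      · simp [hst]
      · intro S hS hne
        refine if_neg ?_
        rintro ⟨hs, ht, -⟩
        refine hne (Finset.eq_of_subset_of_card_le ?_ ?_).symm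
        · intro x hx
          rcases Finset.mem_insert.1 hx with rfl | hx
          · exact hs
          · rwa [Finset.mem_singleton.1 hx]
        · rw [(Finset.mem_powersetCard.1 hS).2, Finset.card_pair hst.ne]
      · intro h
        exact absurd (Finset.mem_powersetCard.2 ⟨Finset.subset_univ _,
          Finset.card_pair hst.ne⟩) h
    · simp [hst]
  have h3 : contractVec (A 0) (contractVec (A 1) (slice 0 z)) ∅ = ∑ s, ∑ t,
      ((if t < s then A 0 s * A 1 t * z ({t, s}, 0) else 0) -
        if s < t then A 0 s * A 1 t * z ({s, t}, 0) else 0) := by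
    rw [contractVec_apply]
    refine Finset.sum_congr rfl fun s _ => ?_
    have : koszulSign R (∅ : Finset (Fin n)) s = 1 := by simp [koszulSign]
    rw [contractOp_apply, if_neg (Finset.notMem_empty s), this, one_mul, contractVec_apply,
      Finset.mul_sum]
    refine Finset.sum_congr rfl fun t _ => ?_
    rw [contractOp_apply, koszulSign_insert (Finset.notMem_empty s)]
    have : koszulSign R (∅ : Finset (Fin n)) t = 1 := by simp [koszulSign]
    rw [this]
    simp only [slice, LinearMap.coe_mk, AddHom.coe_mk, insert_empty_eq, Finset.mem_singleton]
    rcases lt_trichotomy s t with h | rfl | h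
    · simp [h, h.not_gt, h.ne', Finset.pair_comm t s, mul_assoc]
    · simp
    · simp [h, h.not_gt, h.ne, mul_assoc]
  rw [h1, h3]
  simp only [Finset.sum_sub_distrib]
  rw [Finset.sum_comm (f := fun s t => if t < s then A 0 s * A 1 t * z ({t, s}, 0) else 0),
    neg_sub, ← Finset.sum_sub_distrib]
  refine Finset.sum_congr rfl fun s _ => ?_
  rw [← Finset.sum_sub_distrib]
  refine Finset.sum_congr rfl fun t _ => ?_
  split_ifs
  · ring
  · ring

/-- The null-homotopy in positive degrees for the minor `A 0 u * A 1 v - A 0 v * A 1 u`: it is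
`(A 1 v • f_u - A 1 u • f_v) ∧ -` combined with raising the exponent of `γ₁`, corrected on the
component without `γ₁` by `-f_u ∧ f_v ∧ ι(A 0)`. -/
def minorHtpy (A : Matrix (Fin 2) (Fin n) R) (u v : Fin n) :
    (Finset (Fin n) × ℕ → R) →ₗ[R] (Finset (Fin n) × ℕ → R) where
  toFun z p := match p.2 with
    | 0 => -wedgeOp u (wedgeOp v (contractVec (A 0) (slice 0 z))) p.1
    | a + 1 => A 1 v * wedgeOp u (slice a z) p.1 - A 1 u * wedgeOp v (slice a z) p.1
  map_add' z w := by
    funext ⟨S, a⟩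
    cases a <;> simp only [map_add, Pi.add_apply] <;> ring
  map_smul' c z := by
    funext ⟨S, a⟩
    cases a <;> simp only [map_smul, Pi.smul_apply, smul_eq_mul, RingHom.id_apply] <;> ring

theorem slice_zero_minorHtpy (A : Matrix (Fin 2) (Fin n) R) (u v : Fin n)
    (z : Finset (Fin n) × ℕ → R) : slice 0 (minorHtpy A u v z) =
      -wedgeOp u (wedgeOp v (contractVec (A 0) (slice 0 z))) := rfl

theorem slice_succ_minorHtpy (A : Matrix (Fin 2) (Fin n) R) (u v : Fin n)
    (z : Finset (Fin n) × ℕ → R) (a : ℕ) : slice (a + 1) (minorHtpy A u v z) =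
      A 1 v • wedgeOp u (slice a z) - A 1 u • wedgeOp v (slice a z) := rfl

theorem enDiff_minorHtpy (A : Matrix (Fin 2) (Fin n) R) (u v : Fin n)
    (z : Finset (Fin n) × ℕ → R) :
    enDiff A (minorHtpy A u v z) + minorHtpy A u v (enDiff A z) =
      (A 0 u * A 1 v - A 0 v * A 1 u) • z := by
  have h : ∀ a, slice a (enDiff A (minorHtpy A u v z)) + slice a (minorHtpy A u v (enDiff A z)) =
      (A 0 u * A 1 v - A 0 v * A 1 u) • slice a z := by
    intro a
    rw [slice_enDiff]
    cases a with
    | zero =>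
      simp only [slice_succ_minorHtpy, slice_zero_minorHtpy, slice_enDiff, map_sub, map_smul,
        map_neg, map_add, contractVec_wedgeOp, contractVec_self, smul_sub, smul_smul,
        contractVec_anticomm (A 1) (A 0), zero_add]
      funext S
      simp only [Pi.add_apply, Pi.sub_apply, Pi.neg_apply, Pi.smul_apply, smul_eq_mul]
      ring
    | succ a =>
      simp only [slice_succ_minorHtpy, slice_enDiff, map_sub, map_smul,
        map_add, contractVec_wedgeOp, smul_sub, smul_smul]
      funext S
      simp only [Pi.add_apply, Pi.sub_apply, Pi.smul_apply, smul_eq_mul]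
      ring
  funext ⟨S, a⟩
  exact congrFun (h a) S

theorem minorHtpy_congr (A : Matrix (Fin 2) (Fin n) R) (u v : Fin n) {i : ℕ}
    {z w : Finset (Fin n) × ℕ → R} (h : ∀ q ∈ enBasis n (i + 1), z q = w q)
    {p : Finset (Fin n) × ℕ} (hp : p ∈ enBasis n (i + 2)) :
    minorHtpy A u v z p = minorHtpy A u v w p := by
  obtain ⟨S, a⟩ := p
  obtain ⟨hS, ha⟩ := mem_enBasis_succ.1 hp
  dsimp only at hS ha
  have key : ∀ T : Finset (Fin n), T.card = i + 2 → ∀ b ≤ i, slice b z T = slice b w T :=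
    fun T hT b hb => h _ (mem_enBasis_succ.2 ⟨hT, hb⟩)
  cases a with
  | zero =>
    change slice 0 (minorHtpy A u v z) S = slice 0 (minorHtpy A u v w) S
    simp only [slice_zero_minorHtpy, Pi.neg_apply, wedgeOp_apply, contractVec_apply,
      contractOp_apply]
    by_cases hu : u ∈ S
    · by_cases hv : v ∈ S.erase u
      · simp only [hu, hv, if_true]
        congr 3
        refine Finset.sum_congr rfl fun s _ => ?_
        split_ifs with hs
        · rfl
        · rw [key _ _ 0 (Nat.zero_le i)]
          rw [Finset.card_insert_of_notMem hs, Finset.card_erase_of_mem hv,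
            Finset.card_erase_of_mem hu]
          omega
      · simp [hv]
    · simp [hu]
  | succ a =>
    change slice (a + 1) (minorHtpy A u v z) S = slice (a + 1) (minorHtpy A u v w) S
    have h2 : ∀ x, wedgeOp x (slice a z) S = wedgeOp x (slice a w) S := by
      intro x
      rw [wedgeOp_apply, wedgeOp_apply]
      split_ifs with hx
      · rw [key _ _ a (by omega)]
        rw [Finset.card_erase_of_mem hx]
        omega
      · rfl
    simp only [slice_succ_minorHtpy, Pi.sub_apply, Pi.smul_apply, h2]

theorem contractVec_single_empty (x : Fin n → R) :
    contractVec x (Pi.single ∅ 1 : Finset (Fin n) → R) = 0 := by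
  funext S
  rw [contractVec_apply]
  refine Finset.sum_eq_zero fun s _ => ?_
  rw [contractOp_apply, Pi.single_eq_of_ne (Finset.insert_ne_empty s S)]
  simp

theorem wedgeOp_wedgeOp_of_card_two (u v : Fin n) (w : Finset (Fin n) → R) {T : Finset (Fin n)}
    (hT : T.card = 2) :
    wedgeOp u (wedgeOp v w) T = wedgeOp u (wedgeOp v (Pi.single ∅ 1)) T * w ∅ := by
  simp only [wedgeOp_apply]
  by_cases hu : u ∈ T
  · by_cases hv : v ∈ T.erase u
    · have h0 : (T.erase u).erase v = ∅ := by
        rw [← Finset.card_eq_zero, Finset.card_erase_of_mem hv, Finset.card_erase_of_mem hu, hT]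
      simp only [hu, hv, if_true, h0, Pi.single_eq_same]
      ring
    · simp [hv]
  · simp [hu]

/-- Multiplication by a maximal minor is null-homotopic on the Eagon–Northcott complex. In degree
`0` the homotopy sends `1` to `f_u ∧ f_v`. -/
theorem nullHomotopic_minor (A : Matrix (Fin 2) (Fin n) R) (u v : Fin n) :
    NullHomotopic (enBasis n) (enEntry A) (A 0 u * A 1 v - A 0 v * A 1 u) := by
  refine ⟨fun i p q => if i = 0 then wedgeOp u (wedgeOp v (Pi.single ∅ 1)) p.1
    else minorHtpy A u v (Pi.single q 1) p, ?_, ?_⟩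
  · rintro p hp q hq
    rw [enBasis_zero, Finset.mem_singleton] at hp hq
    subst hp hq
    simp only [if_true]
    change actOn (enBasis n 1) (enEntry A 0)
      (fun r => wedgeOp u (wedgeOp v (Pi.single ∅ 1)) r.1) (∅, 0) = _
    rw [actOn_enEntry_zero]
    have : slice 0 (fun r : Finset (Fin n) × ℕ =>
      wedgeOp u (wedgeOp v (Pi.single ∅ (1 : R))) r.1) =
      wedgeOp u (wedgeOp v (Pi.single ∅ 1)) := rfl
    rw [this]
    simp only [contractVec_wedgeOp, map_sub, map_smul, contractVec_single_empty,
      map_zero, sub_zero, smul_smul]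
    simp
    ring
  · intro i p hp q hq
    have e1 : ∑ r ∈ enBasis n (i + 2), enEntry A (i + 1) p r *
        (if i + 1 = 0 then wedgeOp u (wedgeOp v (Pi.single ∅ 1)) r.1
          else minorHtpy A u v (Pi.single q 1) r) =
        enDiff A (minorHtpy A u v (Pi.single q 1)) p :=
      actOn_enEntry_succ A i (minorHtpy A u v (Pi.single q 1)) hp
    have e2 : ∑ r ∈ enBasis n i, (if i = 0 then wedgeOp u (wedgeOp v (Pi.single ∅ 1)) p.1
          else minorHtpy A u v (Pi.single r 1) p) * enEntry A i r q =
        minorHtpy A u v (enDiff A (Pi.single q 1)) p := by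
      have hcol : ∀ r, actOn (enBasis n (i + 1)) (enEntry A i) (Pi.single q 1) r =
          enEntry A i r q := by
        intro r
        rw [actOn_apply, Finset.sum_eq_single q]
        · simp
        · intro q' _ hq'
          rw [Pi.single_eq_of_ne hq', mul_zero]
        · exact fun h => absurd hq h
      cases i with
      | zero =>
        obtain ⟨T, a⟩ := p
        obtain ⟨hT, ha⟩ := mem_enBasis_succ.1 hp
        obtain rfl : a = 0 := by simpa using ha
        simp only [enBasis_zero, Finset.sum_singleton, if_true]
        change _ = slice 0 (minorHtpy A u v (enDiff A (Pi.single q 1))) T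
        rw [slice_zero_minorHtpy, slice_enDiff, map_add, contractVec_self, zero_add,
          Pi.neg_apply, ← hcol, actOn_enEntry_zero, mul_neg, neg_inj]
        exact (wedgeOp_wedgeOp_of_card_two u v _ (by simpa using hT)).symm
      | succ i =>
        simp only [Nat.succ_ne_zero, if_false]
        have h1 : minorHtpy A u v (∑ r ∈ enBasis n (i + 1), enEntry A (i + 1) r q •
            (Pi.single r 1 : Finset (Fin n) × ℕ → R)) p =
            minorHtpy A u v (enDiff A (Pi.single q 1)) p := by
          refine minorHtpy_congr A u v (fun r hr => ?_) hp
          rw [← actOn_enEntry_succ A i _ hr, hcol, Finset.sum_apply, Finset.sum_eq_single r]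
          · simp
          · intro r' _ hr'
            simp [Pi.single_eq_of_ne (Ne.symm hr')]
          · exact fun h => absurd hr h
        rw [← h1, map_sum, Finset.sum_apply]
        refine Finset.sum_congr rfl fun r _ => ?_
        rw [map_smul, Pi.smul_apply, smul_eq_mul, mul_comm]
    rw [e1, e2]
    have := congrFun (enDiff_minorHtpy A u v (Pi.single q 1)) p
    rw [Pi.add_apply] at this
    rw [this, Pi.smul_apply, Pi.single_apply, smul_eq_mul, mul_ite, mul_one, mul_zero]

end MinorHomotopy

/-! ### Regular sequences from pure-power leading terms -/

section LeadingTerms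

open MvPolynomial

variable {k : Type u} [CommRing k] {σ : Type} (w : σ → ℕ)

/-- Polynomials all of whose monomials have weight less than `W`. -/
def weightLT (k : Type u) [CommRing k] (w : σ → ℕ) (W : ℕ) : Submodule k (MvPolynomial σ k) :=
  restrictSupport k {α | Finsupp.weight w α < W}

variable {w}

theorem mem_weightLT {W : ℕ} {p : MvPolynomial σ k} :
    p ∈ weightLT k w W ↔ ∀ α ∈ p.support, Finsupp.weight w α < W :=
  mem_restrictSupport_iff k

theorem weightLT_mono {W W' : ℕ} (h : W ≤ W') : weightLT k w W ≤ weightLT k w W' :=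
  restrictSupport_mono _ fun _ hα => lt_of_lt_of_le hα h

theorem monomial_mem_weightLT {W : ℕ} {α : σ →₀ ℕ} (h : Finsupp.weight w α < W) (c : k) :
    monomial α c ∈ weightLT k w W :=
  (monomial_mem_restrictSupport k).2 (Or.inl h)

theorem mul_mem_weightLT {a b : ℕ} {p q : MvPolynomial σ k} (hp : p ∈ weightLT k w a)
    (hq : q ∈ weightLT k w (b + 1)) : p * q ∈ weightLT k w (a + b) := by
  classical
  rw [mem_weightLT] at *
  intro α hα
  obtain ⟨β, hβ, γ, hγ, rfl⟩ := Finset.mem_add.1 (support_mul p q hα)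
  have := hp β hβ
  have := hq γ hγ
  rw [map_add]
  omega

theorem eq_zero_of_mem_weightLT_zero {p : MvPolynomial σ k} (hp : p ∈ weightLT k w 0) : p = 0 := by
  rw [← support_eq_empty, Finset.eq_empty_iff_forall_notMem]
  exact fun α hα => absurd (mem_weightLT.1 hp α hα) (Nat.not_lt_zero _)

theorem exists_mem_weightLT (p : MvPolynomial σ k) : ∃ W, p ∈ weightLT k w W :=
  ⟨p.support.sup (Finsupp.weight w) + 1,
    mem_weightLT.2 fun _ hα => Nat.lt_succ_of_le (Finset.le_sup hα)⟩

/-- `p` is monic with leading monomial `X^α`, all other monomials having smaller weight. -/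
def HasLeadingMonomial (w : σ → ℕ) (p : MvPolynomial σ k) (α : σ →₀ ℕ) : Prop :=
  p - monomial α 1 ∈ weightLT k w (Finsupp.weight w α)

theorem HasLeadingMonomial.mem {p : MvPolynomial σ k} {α : σ →₀ ℕ}
    (h : HasLeadingMonomial w p α) : p ∈ weightLT k w (Finsupp.weight w α + 1) := by
  rw [← sub_add_cancel p (monomial α 1)]
  exact add_mem (weightLT_mono (Nat.le_succ _) h) (monomial_mem_weightLT (Nat.lt_succ_self _) 1)

theorem hasLeadingMonomial_monomial (α : σ →₀ ℕ) :
    HasLeadingMonomial w (monomial α (1 : k)) α := by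
  rw [HasLeadingMonomial, sub_self]
  exact zero_mem _

theorem HasLeadingMonomial.mul {p q : MvPolynomial σ k} {α β : σ →₀ ℕ}
    (hp : HasLeadingMonomial w p α) (hq : HasLeadingMonomial w q β) :
    HasLeadingMonomial w (p * q) (α + β) := by
  have h : p * q - monomial (α + β) 1 =
      (p - monomial α 1) * q + (q - monomial β 1) * monomial α 1 := by
    rw [show monomial (α + β) (1 : k) = monomial α 1 * monomial β 1 by
      rw [monomial_mul, one_mul]]
    ring
  rw [HasLeadingMonomial, h, map_add]
  refine add_mem (mul_mem_weightLT hp hq.mem) ?_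
  rw [add_comm]
  exact mul_mem_weightLT hq (monomial_mem_weightLT (Nat.lt_succ_self _) 1)

theorem HasLeadingMonomial.one : HasLeadingMonomial w (1 : MvPolynomial σ k) 0 :=
  hasLeadingMonomial_monomial 0

theorem HasLeadingMonomial.pow {p : MvPolynomial σ k} {α : σ →₀ ℕ}
    (hp : HasLeadingMonomial w p α) (j : ℕ) : HasLeadingMonomial w (p ^ j) (j • α) := by
  induction j with
  | zero => simpa using HasLeadingMonomial.one
  | succ j ih => rw [pow_succ, succ_nsmul]; exact ih.mul hp

theorem HasLeadingMonomial.prod {ι : Type} (s : Finset ι) {p : ι → MvPolynomial σ k}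
    {α : ι → σ →₀ ℕ} (hp : ∀ i, HasLeadingMonomial w (p i) (α i)) :
    HasLeadingMonomial w (∏ i ∈ s, p i) (∑ i ∈ s, α i) := by
  classical
  induction s using Finset.induction_on with
  | empty => simpa using HasLeadingMonomial.one
  | insert i s hi ih => rw [Finset.prod_insert hi, Finset.sum_insert hi]; exact (hp i).mul ih

theorem mem_span_X_pow_of_mul_mem {m : σ → ℕ} {T : Set σ} {i : σ} (hi : i ∉ T) {p : MvPolynomial σ k}
    (hp : X i ^ m i * p ∈ Ideal.span ((fun j => (X j : MvPolynomial σ k) ^ m j) '' T)) :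
    p ∈ Ideal.span ((fun j => (X j : MvPolynomial σ k) ^ m j) '' T) := by
  classical
  have himg : (fun j => (X j : MvPolynomial σ k) ^ m j) '' T =
      (fun s => monomial s 1) '' ((fun j => Finsupp.single j (m j)) '' T) := by
    rw [Set.image_image]
    simp only [X_pow_eq_monomial]
  rw [himg, mem_ideal_span_monomial_image] at hp ⊢
  intro α hα
  obtain ⟨_, ⟨j, hj, rfl⟩, hle⟩ := hp (Finsupp.single i (m i) + α) (by
    rw [mem_support_iff, X_pow_eq_monomial, coeff_monomial_mul, one_mul]
    exact mem_support_iff.1 hα)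
  refine ⟨_, ⟨j, hj, rfl⟩, Finsupp.single_le_iff.2 ?_⟩
  have h := Finsupp.single_le_iff.1 hle
  have hji : j ≠ i := fun h => hi (h ▸ hj)
  rwa [Finsupp.add_apply, Finsupp.single_eq_of_ne hji, zero_add] at h

variable [Fintype σ]

/-- The `k`-linear endomorphism sending the monomial `∏ X_i ^ (m_i q_i + r_i)`, with `r_i < m_i`,
to `∏ x_i ^ q_i X_i ^ r_i`. -/
def substPowers (x : σ → MvPolynomial σ k) (m : σ → ℕ) : MvPolynomial σ k →ₗ[k] MvPolynomial σ k :=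
  (basisMonomials σ k).constr k fun α => ∏ i, x i ^ (α i / m i) * X i ^ (α i % m i)

theorem substPowers_monomial (x : σ → MvPolynomial σ k) (m : σ → ℕ) (α : σ →₀ ℕ) :
    substPowers x m (monomial α 1) = ∏ i, x i ^ (α i / m i) * X i ^ (α i % m i) := by
  have := (basisMonomials σ k).constr_basis k
    (fun α => ∏ i, x i ^ (α i / m i) * (X i : MvPolynomial σ k) ^ (α i % m i)) α
  rwa [coe_basisMonomials] at this

/-- `substPowers` turns multiplication by `X_i ^ m_i` into multiplication by `x_i`. -/
theorem substPowers_X_pow_mul (x : σ → MvPolynomial σ k) {m : σ → ℕ} (hm : ∀ i, 0 < m i) (i : σ)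
    (p : MvPolynomial σ k) : substPowers x m (X i ^ m i * p) = x i * substPowers x m p := by
  classical
  suffices h : (substPowers x m).comp (LinearMap.mulLeft k (X i ^ m i)) =
      (LinearMap.mulLeft k (x i)).comp (substPowers x m) from LinearMap.congr_fun h p
  refine (basisMonomials σ k).ext fun α => ?_
  simp only [coe_basisMonomials, LinearMap.comp_apply, LinearMap.mulLeft_apply]
  have : (X i : MvPolynomial σ k) ^ m i * monomial α 1 =
      monomial (Finsupp.single i (m i) + α) 1 := by
    rw [X_pow_eq_monomial, monomial_mul, one_mul]
  rw [this, substPowers_monomial, substPowers_monomial, ← Finset.mul_prod_erase _ _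
    (Finset.mem_univ i), ← Finset.mul_prod_erase (Finset.univ : Finset σ)
    (fun j => x j ^ (α j / m j) * (X j : MvPolynomial σ k) ^ (α j % m j)) (Finset.mem_univ i)]
  rw [Finsupp.add_apply, Finsupp.single_eq_same, Nat.add_mod_left, Nat.add_div_left _ (hm i),
    pow_succ']
  rw [Finset.prod_congr rfl (fun j hj => by
    rw [Finsupp.add_apply, Finsupp.single_eq_of_ne (Finset.ne_of_mem_erase hj), zero_add])]
  ring

variable {x : σ → MvPolynomial σ k} {m : σ → ℕ}

theorem hasLeadingMonomial_substPowers
    (hx : ∀ i, HasLeadingMonomial w (x i) (Finsupp.single i (m i))) (α : σ →₀ ℕ) :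
    HasLeadingMonomial w (substPowers x m (monomial α 1)) α := by
  rw [substPowers_monomial]
  have h := HasLeadingMonomial.prod (w := w) Finset.univ
    (p := fun i => x i ^ (α i / m i) * (X i : MvPolynomial σ k) ^ (α i % m i))
    (α := fun i => (α i / m i) • Finsupp.single i (m i) + Finsupp.single i (α i % m i))
    (fun i => ((hx i).pow _).mul (by
      rw [X_pow_eq_monomial]
      exact hasLeadingMonomial_monomial _))
  have h2 : ∑ i, ((α i / m i) • Finsupp.single i (m i) + Finsupp.single i (α i % m i)) = α := by
    conv_rhs => rw [← Finsupp.univ_sum_single α]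
    refine Finset.sum_congr rfl fun i _ => ?_
    rw [Finsupp.smul_single, ← Finsupp.single_add, smul_eq_mul, Nat.div_add_mod']
  rwa [h2] at h

theorem substPowers_sub_mem (hx : ∀ i, HasLeadingMonomial w (x i) (Finsupp.single i (m i)))
    {W : ℕ} {p : MvPolynomial σ k} (hp : p ∈ weightLT k w (W + 1)) :
    substPowers x m p - p ∈ weightLT k w W := by
  suffices h : weightLT k w (W + 1) ≤
      (weightLT k w W).comap (substPowers x m - LinearMap.id) from h hp
  rw [weightLT, restrictSupport_eq_span, Submodule.span_le]
  rintro _ ⟨α, hα, rfl⟩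
  exact weightLT_mono (Nat.lt_succ_iff.1 hα) (hasLeadingMonomial_substPowers hx α)

theorem substPowers_injective (hx : ∀ i, HasLeadingMonomial w (x i) (Finsupp.single i (m i))) :
    Function.Injective (substPowers x m) := by
  rw [injective_iff_map_eq_zero]
  intro p hp
  obtain ⟨W, hW⟩ := exists_mem_weightLT (w := w) p
  refine eq_zero_of_mem_weightLT_zero (w := w) ?_
  induction W with
  | zero => exact hW
  | succ W ih =>
    refine ih ?_
    have := substPowers_sub_mem hx hW
    rwa [hp, zero_sub, neg_mem_iff] at this

theorem substPowers_surjective (hx : ∀ i, HasLeadingMonomial w (x i) (Finsupp.single i (m i))) :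
    Function.Surjective (substPowers x m) := by
  intro p
  obtain ⟨W, hW⟩ := exists_mem_weightLT (w := w) p
  induction W generalizing p with
  | zero => exact ⟨0, by rw [map_zero, eq_zero_of_mem_weightLT_zero hW]⟩
  | succ W ih =>
    obtain ⟨q, hq⟩ := ih _ (substPowers_sub_mem hx hW)
    exact ⟨p - q, by rw [map_sub, hq, sub_sub_cancel]⟩

theorem substPowers_mem_span (hm : ∀ i, 0 < m i) {T : Set σ} {p : MvPolynomial σ k}
    (hp : p ∈ Ideal.span ((fun i => (X i : MvPolynomial σ k) ^ m i) '' T)) :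
    substPowers x m p ∈ Ideal.span (x '' T) := by
  induction hp using Submodule.closure_induction with
  | zero => rw [map_zero]; exact zero_mem _
  | add p q _ _ hp hq => rw [map_add]; exact add_mem hp hq
  | smul_mem r p hp =>
    obtain ⟨i, hi, rfl⟩ := hp
    rw [smul_eq_mul, mul_comm, substPowers_X_pow_mul x hm]
    exact Ideal.mul_mem_right _ _ (Ideal.subset_span ⟨i, hi, rfl⟩)

theorem exists_substPowers_eq_of_mem_span (hm : ∀ i, 0 < m i)
    (hx : ∀ i, HasLeadingMonomial w (x i) (Finsupp.single i (m i))) {T : Set σ}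
    {y : MvPolynomial σ k} (hy : y ∈ Ideal.span (x '' T)) :
    ∃ p ∈ Ideal.span ((fun i => (X i : MvPolynomial σ k) ^ m i) '' T), substPowers x m p = y := by
  induction hy using Submodule.closure_induction with
  | zero => exact ⟨0, zero_mem _, map_zero _⟩
  | add _ _ _ _ hp hq =>
    obtain ⟨p, hp, rfl⟩ := hp
    obtain ⟨q, hq, rfl⟩ := hq
    exact ⟨p + q, add_mem hp hq, map_add _ _ _⟩
  | smul_mem r _ hp =>
    obtain ⟨i, hi, rfl⟩ := hp
    obtain ⟨s, rfl⟩ := substPowers_surjective hx r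
    exact ⟨X i ^ m i * s, Ideal.mul_mem_right _ _ (Ideal.subset_span ⟨i, hi, rfl⟩), by
      rw [substPowers_X_pow_mul x hm, smul_eq_mul, mul_comm]⟩

/-- Elements whose leading monomials are powers of distinct variables form a regular sequence, in
any order: the bijection `substPowers` reduces this to the powers themselves. -/
theorem mem_span_of_mul_mem (hm : ∀ i, 0 < m i)
    (hx : ∀ i, HasLeadingMonomial w (x i) (Finsupp.single i (m i))) {T : Set σ} {i : σ}
    (hi : i ∉ T) {z : MvPolynomial σ k} (hz : x i * z ∈ Ideal.span (x '' T)) :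
    z ∈ Ideal.span (x '' T) := by
  obtain ⟨p, rfl⟩ := substPowers_surjective hx z
  obtain ⟨q, hq, hqz⟩ := exists_substPowers_eq_of_mem_span hm hx hz
  rw [← substPowers_X_pow_mul x hm] at hqz
  rw [substPowers_injective hx hqz] at hq
  exact substPowers_mem_span hm (mem_span_X_pow_of_mul_mem hi hq)

end LeadingTerms

/-! ### Zeroth homology of the Eagon–Northcott complex and of its dual -/

section ZerothHomology

variable {R : Type u} [CommRing R] {n : ℕ} (A : Matrix (Fin 2) (Fin n) R)

/-- The ideal of maximal minors. -/
def minorIdeal : Ideal R :=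
  Ideal.span (Set.range fun c : Fin n × Fin n => A 0 c.1 * A 1 c.2 - A 0 c.2 * A 1 c.1)

theorem minor_mem (s t : Fin n) : A 0 s * A 1 t - A 0 t * A 1 s ∈ minorIdeal A :=
  Ideal.subset_span ⟨(s, t), rfl⟩

theorem enEntry_zero_mem (p q : Finset (Fin n) × ℕ) : enEntry A 0 p q ∈ minorIdeal A := by
  rw [enEntry, if_pos rfl]
  refine Ideal.sum_mem _ fun s _ => Ideal.sum_mem _ fun t _ => ?_
  split_ifs
  · exact minor_mem A s t
  · exact zero_mem _

theorem nullHomotopic_of_mem_minorIdeal {x : R} (hx : x ∈ minorIdeal A) :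
    NullHomotopic (enBasis n) (enEntry A) x := by
  induction hx using Submodule.span_induction with
  | mem x hx =>
    obtain ⟨⟨u, v⟩, rfl⟩ := hx
    exact nullHomotopic_minor A u v
  | zero => exact NullHomotopic.zero
  | add _ _ _ _ hx hy => exact hx.add hy
  | smul c _ _ hx => exact hx.mul_left c

theorem mem_boundaries_zero_iff (z : Finset (Fin n) × ℕ → R) :
    z ∈ boundaries (enBasis n) (enEntry A) 0 ↔ z (∅, 0) ∈ minorIdeal A := by
  constructor
  · rintro ⟨v, hv⟩
    rw [hv (∅, 0) (by simp [enBasis_zero]), actOn_apply]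
    exact Ideal.sum_mem _ fun q _ => Ideal.mul_mem_right _ _ (enEntry_zero_mem A _ q)
  · intro hz
    obtain ⟨v, hv⟩ := (nullHomotopic_of_mem_minorIdeal A hz).smul_mem_boundaries 1
    refine ⟨v, fun p hp => ?_⟩
    rw [← hv p hp]
    rw [enBasis_zero, Finset.mem_singleton] at hp
    simp [hp]

theorem mem_dualBasis_zero (hn : 2 ≤ n) {p : Finset (Fin n) × ℕ} :
    p ∈ dualBasis (n - 1) (enBasis n) 0 ↔ p.1 = Finset.univ ∧ p.2 < n - 1 := by
  have h1 : n - 1 - 0 = (n - 2) + 1 := by omega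
  rw [dualBasis, if_pos (Nat.zero_le _), h1, mem_enBasis_succ,
    show n - 2 + 2 = Fintype.card (Fin n) by rw [Fintype.card_fin]; omega, Finset.card_eq_iff_eq_univ]
  refine and_congr_right fun _ => ?_
  omega

/-- The linear form on degree `0` of the dual complex with value `c a` on `g₁^a g₂^(n-2-a)`. -/
def dualForm (n : ℕ) (c : ℕ → R) : (Finset (Fin n) × ℕ → R) →ₗ[R] R :=
  ∑ q ∈ dualBasis (n - 1) (enBasis n) 0, c q.2 • LinearMap.proj q

theorem dualForm_apply (c : ℕ → R) (z : Finset (Fin n) × ℕ → R) :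
    dualForm n c z = ∑ q ∈ dualBasis (n - 1) (enBasis n) 0, c q.2 * z q := by
  simp [dualForm, LinearMap.sum_apply]

variable {A}

/-- A linear form compatible with the relations `A 0 s g₁ + A 1 s g₂ = 0` modulo the minors
induces a map from the zeroth homology of the dual complex to `R ⧸ I₂`. -/
theorem dualForm_mem_minorIdeal (hn : 2 ≤ n) {c : ℕ → R}
    (hc : ∀ a, a + 2 < n → ∀ s, A 0 s * c (a + 1) + A 1 s * c a ∈ minorIdeal A)
    {z : Finset (Fin n) × ℕ → R}
    (hz : z ∈ boundaries (dualBasis (n - 1) (enBasis n)) (dualEntry (n - 1) (enEntry A)) 0) :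
    dualForm n c z ∈ minorIdeal A := by
  obtain ⟨v, hv⟩ := hz
  rw [dualForm_apply, Finset.sum_congr rfl fun q hq => by rw [hv q hq, actOn_apply,
    Finset.mul_sum], Finset.sum_comm]
  refine Ideal.sum_mem _ fun r hr => ?_
  simp only [← mul_assoc, ← Finset.sum_mul]
  refine Ideal.mul_mem_right _ _ ?_
  obtain ⟨m, rfl⟩ : ∃ m, n = m + 2 := ⟨n - 2, by omega⟩
  have e1 : m + 2 - 1 = m + 1 := rfl
  have e2 : m + 1 - (0 + 1) = m := by omega
  simp only [e1, dualBasis, dualEntry, e2, Nat.le_add_left, if_true, Nat.sub_zero,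
    show (0 + 1 ≤ m + 1) by omega] at hr ⊢
  rcases m with _ | m
  · exact Ideal.sum_mem _ fun q _ => Ideal.mul_mem_left _ _ (enEntry_zero_mem A _ q)
  · have h := actOn_enEntry_succ A m (fun q => c q.2) hr
    rw [actOn_apply] at h
    simp only [mul_comm (c _)]
    rw [h]
    simp only [enDiff, contractVec_apply, ← Finset.sum_add_distrib]
    refine Ideal.sum_mem _ fun s _ => ?_
    have hr2 := (mem_enBasis_succ.1 hr).2
    rw [contractOp_apply, contractOp_apply]
    split_ifs
    · simp
    · have := Ideal.mul_mem_left _ (koszulSign R r.1 s) (hc r.2 (by omega) s)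
      convert this using 1
      simp only [slice, LinearMap.coe_mk, AddHom.coe_mk]
      ring

variable (A)

/-- The relation `A 0 s g₁^(a+1) g₂^(n-3-a) + A 1 s g₁^a g₂^(n-2-a) = 0` in the zeroth homology of
the dual complex. -/
theorem relation_mem_boundaries {a : ℕ} (ha : a + 2 < n) (s : Fin n) :
    A 0 s • (Pi.single (Finset.univ, a + 1) 1 : Finset (Fin n) × ℕ → R) +
      A 1 s • Pi.single (Finset.univ, a) 1 ∈
      boundaries (dualBasis (n - 1) (enBasis n)) (dualEntry (n - 1) (enEntry A)) 0 := by
  refine ⟨koszulSign R Finset.univ s • Pi.single (Finset.univ.erase s, a) 1, fun p hp => ?_⟩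
  obtain ⟨S, b⟩ := p
  obtain ⟨rfl, hb⟩ : S = Finset.univ ∧ b < n - 1 := (mem_dualBasis_zero (by omega)).1 hp
  obtain ⟨m, rfl⟩ : ∃ m, n = m + 3 := ⟨n - 3, by omega⟩
  have e1 : m + 3 - 1 = m + 2 := rfl
  have e2 : m + 2 - (0 + 1) = m + 1 := by omega
  rw [map_smul, Pi.smul_apply, actOn_apply, Finset.sum_eq_single (Finset.univ.erase s, a)]
  · rw [Pi.single_eq_same, mul_one, dualEntry, e1, e2, enEntry, if_neg (by omega)]
    dsimp only
    rw [Finset.sum_eq_single s]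
    · rw [if_pos rfl, smul_eq_mul, ← mul_assoc, koszulSign_mul_self, one_mul]
      simp [Pi.single_apply, Prod.ext_iff]
    · intro t _ ht
      refine if_neg fun h => ?_
      have : t ∈ Finset.univ.erase s := Finset.mem_erase.2 ⟨ht, Finset.mem_univ t⟩
      rw [← h] at this
      simp at this
    · simp
  · intro q _ hq
    rw [Pi.single_eq_of_ne hq, mul_zero]
  · intro h
    refine absurd ?_ h
    rw [dualBasis, if_pos (by omega), e1, e2, mem_enBasis_succ]
    refine ⟨?_, by dsimp only; omega⟩
    rw [Finset.card_erase_of_mem (Finset.mem_univ s), Finset.card_univ, Fintype.card_fin]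
    omega

/-- After multiplication by a power of `A 0 s`, the zeroth homology of the dual complex is
generated by `g₂^(n-2)`. -/
theorem exists_pow_smul_sub_mem_boundaries (s : Fin n) (hn : 2 ≤ n)
    (z : Finset (Fin n) × ℕ → R) :
    ∃ r : R, A 0 s ^ n • z - r • Pi.single (Finset.univ, 0) 1 ∈
      boundaries (dualBasis (n - 1) (enBasis n)) (dualEntry (n - 1) (enEntry A)) 0 := by
  set Z := boundaries (dualBasis (n - 1) (enBasis n)) (dualEntry (n - 1) (enEntry A)) 0 with hZ
  set δ : ℕ → Finset (Fin n) × ℕ → R := fun a => Pi.single (Finset.univ, a) 1 with hδ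
  have h1 : ∀ a, a + 1 < n → A 0 s ^ a • δ a - (-A 1 s) ^ a • δ 0 ∈ Z := by
    intro a
    induction a with
    | zero => intro _; simp
    | succ a ih =>
      intro ha
      have h2 := Z.sub_mem (Z.smul_mem (A 0 s ^ a) (relation_mem_boundaries A (a := a) ha s))
        (Z.smul_mem (A 1 s) (ih (by omega)))
      convert h2 using 1
      simp only [hδ, smul_add, smul_sub, smul_smul, pow_succ]
      rw [mul_comm (A 1 s) (A 0 s ^ a)]
      have : A 1 s * (-A 1 s) ^ a = -((-A 1 s) ^ a * -A 1 s) := by ring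
      rw [this, neg_smul]
      abel
  have h3 : z - ∑ a ∈ Finset.range (n - 1), z (Finset.univ, a) • δ a ∈ Z := by
    refine ⟨0, fun p hp => ?_⟩
    obtain ⟨S, b⟩ := p
    obtain ⟨rfl, hb⟩ : S = Finset.univ ∧ b < n - 1 := (mem_dualBasis_zero hn).1 hp
    rw [map_zero, Pi.zero_apply, Pi.sub_apply, Finset.sum_apply, Finset.sum_eq_single b]
    · simp [hδ]
    · intro a _ hab
      simp [hδ, Ne.symm hab]
    · intro h
      exact absurd (Finset.mem_range.2 hb) h
  refine ⟨∑ a ∈ Finset.range (n - 1), z (Finset.univ, a) * A 0 s ^ (n - a) * (-A 1 s) ^ a, ?_⟩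
  have h4 := Z.add_mem (Z.smul_mem (A 0 s ^ n) h3) (Z.sum_mem (t := Finset.range (n - 1))
    (f := fun a => (z (Finset.univ, a) * A 0 s ^ (n - a)) •
      (A 0 s ^ a • δ a - (-A 1 s) ^ a • δ 0)) fun a ha => Z.smul_mem _ (h1 a (by
        have := Finset.mem_range.1 ha
        omega)))
  convert h4 using 1
  simp only [smul_sub, smul_smul, Finset.sum_sub_distrib, Finset.smul_sum, Finset.sum_smul]
  have h5 : ∑ a ∈ Finset.range (n - 1), (A 0 s ^ n * z (Finset.univ, a)) • δ a =
      ∑ a ∈ Finset.range (n - 1), (z (Finset.univ, a) * A 0 s ^ (n - a) * A 0 s ^ a) • δ a := by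
    refine Finset.sum_congr rfl fun a ha => ?_
    have := Finset.mem_range.1 ha
    rw [mul_assoc, ← pow_add, Nat.sub_add_cancel (by omega), mul_comm]
  rw [h5]
  abel

/-- If `A 0 s` is a nonzerodivisor on the zeroth homology of the dual complex and `c 0` is one
on `R ⧸ I₂`, then the map between these modules induced by the form `c` is injective. -/
theorem mem_boundaries_of_dualForm_mem (hn : 2 ≤ n) {c : ℕ → R}
    (hc : ∀ a, a + 2 < n → ∀ s, A 0 s * c (a + 1) + A 1 s * c a ∈ minorIdeal A) (s : Fin n)
    (hs : ∀ z, A 0 s • z ∈ boundaries (dualBasis (n - 1) (enBasis n))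
      (dualEntry (n - 1) (enEntry A)) 0 →
      z ∈ boundaries (dualBasis (n - 1) (enBasis n)) (dualEntry (n - 1) (enEntry A)) 0)
    (hc0 : ∀ r, c 0 * r ∈ minorIdeal A → r ∈ minorIdeal A) {z : Finset (Fin n) × ℕ → R}
    (hz : dualForm n c z ∈ minorIdeal A) :
    z ∈ boundaries (dualBasis (n - 1) (enBasis n)) (dualEntry (n - 1) (enEntry A)) 0 := by
  obtain ⟨r, hr⟩ := exists_pow_smul_sub_mem_boundaries A s hn z
  have h1 := dualForm_mem_minorIdeal hn hc hr
  have h2 : dualForm n c (Pi.single (Finset.univ, 0) 1) = c 0 := by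
    rw [dualForm_apply, Finset.sum_eq_single (Finset.univ, 0)]
    · simp
    · intro q _ hq
      rw [Pi.single_eq_of_ne hq, mul_zero]
    · intro h
      exact absurd ((mem_dualBasis_zero hn).2 ⟨rfl, by dsimp only; omega⟩) h
  rw [map_sub, map_smul, map_smul, h2] at h1
  have h3 : r ∈ minorIdeal A := hc0 r (by
    have := sub_mem (Ideal.mul_mem_left _ (A 0 s ^ n) hz) h1
    rwa [smul_eq_mul, sub_sub_cancel, smul_eq_mul, mul_comm] at this)
  have h4 : r • (Pi.single (Finset.univ, 0) 1 : Finset (Fin n) × ℕ → R) ∈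
      boundaries (dualBasis (n - 1) (enBasis n)) (dualEntry (n - 1) (enEntry A)) 0 :=
    ((nullHomotopic_of_mem_minorIdeal A h3).dual (by omega)
      (enBasis_eq_empty (by omega) (by omega))).smul_mem_boundaries _
  have h5 := add_mem hr h4
  rw [sub_add_cancel] at h5
  have h6 : ∀ j, A 0 s ^ j • z ∈ boundaries (dualBasis (n - 1) (enBasis n))
      (dualEntry (n - 1) (enEntry A)) 0 →
      z ∈ boundaries (dualBasis (n - 1) (enBasis n)) (dualEntry (n - 1) (enEntry A)) 0 := by
    intro j
    induction j with
    | zero => simp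
    | succ j ih =>
      intro h
      rw [pow_succ', mul_smul] at h
      exact ih (hs _ h)
  exact h6 n h5

end ZerothHomology

/-! ### Exactness for the matrix of the semigroup -/

section SallyExact

open MvPolynomial

variable (k : Type u) [Field k] (e : ℕ)

theorem sallyMatrix_zero (s : Fin (e - 2)) : sallyMatrix k e 0 s = sallyX k e (s + 2) := by
  simp [sallyMatrix]

theorem sallyMatrix_one (s : Fin (e - 2)) : sallyMatrix k e 1 s = sallyX k e (s + 3) := by
  simp only [sallyMatrix, Matrix.of_apply, Fin.val_one]
  congr 1
  omega

theorem sallyX_of_lt {i : ℕ} (h : i < e ∧ i ≠ 1) : sallyX k e i = X ⟨i, h⟩ := dif_pos h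

instance : Finite (SallyIdx e) :=
  Set.Finite.to_subtype ((Set.finite_lt_nat e).subset fun _ h => h.1)

/-- A weight of `X_j`, strictly concave in `j ≥ 1` and smaller at `j = 0`, for which the leading
monomials of `X_2^2 - X_0 X_4` and `X_j^2 - X_(j-1) X_(j+1)` are the squares. The index `e` has
twice the weight of `0`, in accordance with `X_e = X_0^2`. -/
def sallyWeight (j : ℕ) : ℕ := if j = 0 then e * e else 2 * (e * e + j * (e - j))

theorem exists_sallyX_eq_monomial {j : ℕ} (he : 0 < e) (hj : j ≤ e) (h1 : j ≠ 1) :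
    ∃ μ : SallyIdx e →₀ ℕ, sallyX k e j = monomial μ 1 ∧
      Finsupp.weight (fun i : SallyIdx e => sallyWeight e i) μ = sallyWeight e j := by
  rcases hj.lt_or_eq with h | rfl
  · refine ⟨Finsupp.single ⟨j, h, h1⟩ 1, ?_, ?_⟩
    · rw [sallyX_of_lt k e ⟨h, h1⟩]
      rfl
    · rw [Finsupp.weight_single, one_smul]
  · refine ⟨Finsupp.single ⟨0, he, by decide⟩ 2, ?_, ?_⟩
    · rw [sallyX, dif_neg (by omega), dif_pos ⟨rfl, he⟩, X_pow_eq_monomial]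
    · rw [Finsupp.weight_single]
      simp [sallyWeight, he.ne']

/-- The variables `X_i` for `i < c`, and for `c ≤ i` the elements `X_2^2 - X_0 X_4` (if `i = 2`)
and `X_i^2 - X_(i-1) X_(i+1)` (if `i ≥ 3`). -/
def sallySeq (c : ℕ) (i : SallyIdx e) : SallyRing k e :=
  if c ≤ i then X i ^ 2 - sallyX k e (if (i : ℕ) = 2 then 0 else i - 1) *
    sallyX k e (if (i : ℕ) = 2 then 4 else i + 1) else X i

theorem sallyWeight_of_pos {j : ℕ} (hj : 0 < j) :
    sallyWeight e j = 2 * (e * e + j * (e - j)) := if_neg hj.ne'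

theorem sallyWeight_lt {i : ℕ} (he : 4 ≤ e) (hi : i < e) (h2 : 2 ≤ i) :
    sallyWeight e (if i = 2 then 0 else i - 1) + sallyWeight e (if i = 2 then 4 else i + 1) <
      2 * sallyWeight e i := by
  by_cases h : i = 2
  · subst h
    rw [if_pos rfl, if_pos rfl, sallyWeight_of_pos e (j := 4) (by omega),
      sallyWeight_of_pos e (j := 2) (by omega), sallyWeight, if_pos rfl]
    obtain ⟨d, rfl⟩ := Nat.exists_eq_add_of_le he
    have h1 : 4 + d - 4 = d := by omega
    have h3 : 4 + d - 2 = d + 2 := by omega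
    rw [h1, h3]
    nlinarith
  · rw [if_neg h, if_neg h, sallyWeight_of_pos e (by omega), sallyWeight_of_pos e (by omega),
      sallyWeight_of_pos e (by omega)]
    obtain ⟨j, rfl⟩ := Nat.exists_eq_add_of_le h2
    obtain ⟨d, rfl⟩ := Nat.exists_eq_add_of_lt hi
    have h1 : 2 + j + d + 1 - (2 + j - 1) = d + 2 := by omega
    have h3 : 2 + j + d + 1 - (2 + j + 1) = d := by omega
    have h4 : 2 + j + d + 1 - (2 + j) = d + 1 := by omega
    have h5 : 2 + j - 1 = j + 1 := by omega
    rw [h1, h3, h4, h5]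
    nlinarith

/-- The degree of the leading monomial of `sallySeq`, a power of a variable. -/
def sallyExp (c : ℕ) (i : SallyIdx e) : ℕ := if c ≤ i then 2 else 1

theorem hasLeadingMonomial_sallySeq (he : 4 ≤ e) {c : ℕ} (hc : 2 ≤ c) (i : SallyIdx e) :
    HasLeadingMonomial (fun i : SallyIdx e => sallyWeight e i) (sallySeq k e c i)
      (Finsupp.single i (sallyExp e c i)) := by
  by_cases h : c ≤ i
  · rw [sallySeq, if_pos h, sallyExp, if_pos h]
    have hi := i.2.1
    obtain ⟨μ, hμ, hwμ⟩ := exists_sallyX_eq_monomial k e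
      (j := if (i : ℕ) = 2 then 0 else (i : ℕ) - 1) (by omega) (by split_ifs <;> omega)
      (by split_ifs <;> omega)
    obtain ⟨ν, hν, hwν⟩ := exists_sallyX_eq_monomial k e
      (j := if (i : ℕ) = 2 then 4 else (i : ℕ) + 1) (by omega) (by split_ifs <;> omega)
      (by split_ifs <;> omega)
    rw [HasLeadingMonomial, hμ, hν, X_pow_eq_monomial, monomial_mul, sub_sub_cancel_left,
      neg_mem_iff]
    refine monomial_mem_weightLT ?_ _
    rw [map_add, hwμ, hwν, Finsupp.weight_single, smul_eq_mul]
    exact sallyWeight_lt e he hi (by omega)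
  · rw [sallySeq, if_neg h, sallyExp, if_neg h]
    exact hasLeadingMonomial_monomial _

/-- The sequence `sallySeq` is regular in any order. -/
theorem mem_span_of_sallySeq_mul_mem (he : 4 ≤ e) {c : ℕ} (hc : 2 ≤ c) {T : Set (SallyIdx e)}
    {i : SallyIdx e} (hi : i ∉ T) {z : SallyRing k e}
    (hz : sallySeq k e c i * z ∈ Ideal.span (sallySeq k e c '' T)) :
    z ∈ Ideal.span (sallySeq k e c '' T) := by
  have := Fintype.ofFinite (SallyIdx e)
  exact mem_span_of_mul_mem (m := sallyExp e c)
    (fun i => by unfold sallyExp; split_ifs <;> omega) (hasLeadingMonomial_sallySeq k e he hc) hi hz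

theorem sallySeq_mem_minorIdeal {i : SallyIdx e} {c : ℕ} (hc : c ≤ 3) (hi : 3 ≤ (i : ℕ)) :
    sallySeq k e c i ∈ minorIdeal (sallyMatrix k e) := by
  have h := i.2.1
  have h2 := minor_mem (sallyMatrix k e) ⟨i - 2, by omega⟩ ⟨i - 3, by omega⟩
  rw [sallyMatrix_zero, sallyMatrix_one, sallyMatrix_zero, sallyMatrix_one] at h2
  dsimp only at h2
  rw [sallySeq, if_pos (by omega), if_neg (by omega), if_neg (by omega), pow_two]
  convert h2 using 2
  · rw [← sallyX_of_lt k e i.2]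
    congr 2 <;> omega
  · congr 2 <;> omega

variable {α : Type} [DecidableEq α] {B : ℕ → Finset α} {D : ℕ → α → α → SallyRing k e}

/-- Exactness in positive degrees modulo `X_2` or `X_2^2 - X_0 X_4`, and absolutely, for a complex
of length `e - 3` on which the minors act null-homotopically; it applies to the Eagon–Northcott
complex and to its dual. -/
theorem sally_exact_mod (he : 4 ≤ e) (hD : IsBasedComplex B D) (hB : ∀ i, e - 3 < i → B i = ∅)
    (hom : ∀ x ∈ minorIdeal (sallyMatrix k e), NullHomotopic B D x) {c : ℕ} (hc2 : 2 ≤ c)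
    (hc3 : c ≤ 3) {T : Set (SallyIdx e)} (hT : ∀ i ∈ T, (i : ℕ) < 3) (i : ℕ)
    (z : α → SallyRing k e)
    (hz : ∀ p ∈ B i, actOn (B (i + 1)) (D i) z p ∈ Ideal.span (sallySeq k e c '' T)) :
    ∃ v, ∀ p ∈ B (i + 1), z p - actOn (B (i + 2)) (D (i + 1)) v p ∈
      Ideal.span (sallySeq k e c '' T) := by
  set idx : ℕ → SallyIdx e := fun q => if h : q + 3 < e then ⟨q + 3, h, by omega⟩
    else ⟨0, by omega, by decide⟩ with hidx
  have hval : ∀ q < e - 3, ((idx q : SallyIdx e) : ℕ) = q + 3 := by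
    intro q hq
    simp only [hidx]
    rw [dif_pos (by omega)]
  have h := exact_mod_of_nullHomotopic hD hB (fun q => sallySeq k e c (idx q))
    (fun q => Ideal.span (sallySeq k e c '' (T ∪ idx '' {j | j < q})))
    (fun q => by
      have : {j | j < q + 1} = {j | j < q} ∪ {q} := by
        ext j
        simp only [Set.mem_ofPred_eq, Set.mem_union, Set.mem_singleton_iff]
        omega
      rw [this, Set.image_union idx, ← Set.union_assoc, Set.image_union (sallySeq k e c) (T ∪ _),
        Ideal.span_union, Set.image_singleton, Set.image_singleton])
    (fun q hq z hz => mem_span_of_sallySeq_mul_mem k e he hc2 (by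
      rintro (h | ⟨j, hj, h⟩)
      · have := hT _ h
        rw [hval q hq] at this
        omega
      · have hj' : j < q := hj
        have h' := congrArg Subtype.val h
        rw [hval q hq, hval j (by omega)] at h'
        omega) hz)
    (fun q hq => hom _ (sallySeq_mem_minorIdeal k e hc3 (by rw [hval q hq]; omega))) i z
  simp only [Nat.not_lt_zero, Set.ofPred_false, Set.image_empty, Set.union_empty] at h
  exact h hz

theorem sally_exact (he : 4 ≤ e) (hD : IsBasedComplex B D) (hB : ∀ i, e - 3 < i → B i = ∅)
    (hom : ∀ x ∈ minorIdeal (sallyMatrix k e), NullHomotopic B D x) (i : ℕ)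
    (z : α → SallyRing k e) (hz : ∀ p ∈ B i, actOn (B (i + 1)) (D i) z p = 0) :
    z ∈ boundaries B D (i + 1) := by
  have h := sally_exact_mod k e he hD hB hom le_rfl (by omega) (T := ∅) (by simp) i z
    (fun p hp => by rw [hz p hp]; exact zero_mem _)
  simp only [Set.image_empty, Ideal.span_empty, Ideal.mem_bot, sub_eq_zero] at h
  exact h

/-- The elements `X_2` and `X_2^2 - X_0 X_4` are nonzerodivisors on the zeroth homology. -/
theorem sally_mem_boundaries_of_smul_mem (he : 4 ≤ e) (hD : IsBasedComplex B D)
    (hB : ∀ i, e - 3 < i → B i = ∅)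
    (hom : ∀ x ∈ minorIdeal (sallyMatrix k e), NullHomotopic B D x) {c : ℕ} (hc2 : 2 ≤ c)
    (hc3 : c ≤ 3) {z : α → SallyRing k e}
    (hz : sallySeq k e c ⟨2, by omega, by decide⟩ • z ∈ boundaries B D 0) :
    z ∈ boundaries B D 0 := by
  refine mem_boundaries_of_smul_mem hD (fun z hz => ?_) (fun z hz => ?_) hz
  · have := mem_span_of_sallySeq_mul_mem k e he hc2 (T := ∅)
      (i := ⟨2, by omega, by decide⟩) (z := z) (by simp) (by rw [hz]; exact zero_mem _)
    simpa using this
  · have h := sally_exact_mod k e he hD hB hom hc2 hc3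
      (T := {⟨2, by omega, by decide⟩}) (by simp) 0 z (by rwa [Set.image_singleton])
    rwa [Set.image_singleton] at h

end SallyExact

section SallyHomology

open MvPolynomial

variable (k : Type u) [Field k] (e : ℕ)

theorem isBasedComplex_enEntry {R : Type u} [CommRing R] {n : ℕ} (A : Matrix (Fin 2) (Fin n) R) :
    IsBasedComplex (enBasis n) (enEntry A) := enEntry_comp A

theorem isBasedComplex_dualEntry {R : Type u} [CommRing R] {n : ℕ}
    (A : Matrix (Fin 2) (Fin n) R) :
    IsBasedComplex (dualBasis (n - 1) (enBasis n)) (dualEntry (n - 1) (enEntry A)) :=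
  dualEntry_comp (n - 1) (enBasis n) (enEntry A) (enEntry_comp A)

theorem nullHomotopic_dual_of_mem_minorIdeal (he : 4 ≤ e) {x : SallyRing k e}
    (hx : x ∈ minorIdeal (sallyMatrix k e)) :
    NullHomotopic (dualBasis (e - 2 - 1) (enBasis (e - 2)))
      (dualEntry (e - 2 - 1) (enEntry (sallyMatrix k e))) x :=
  (nullHomotopic_of_mem_minorIdeal _ hx).dual (by omega) (enBasis_eq_empty (by omega) (by omega))

theorem enBasis_sally_eq_empty (he : 4 ≤ e) (i : ℕ) (hi : e - 3 < i) : enBasis (e - 2) i = ∅ :=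
  enBasis_eq_empty (by omega) (by omega)

theorem dualBasis_sally_eq_empty (he : 4 ≤ e) (i : ℕ) (hi : e - 3 < i) :
    dualBasis (e - 2 - 1) (enBasis (e - 2)) i = ∅ :=
  if_neg (by omega)

theorem sally_exact_en (he : 4 ≤ e) (i : ℕ) (z : Finset (Fin (e - 2)) × ℕ → SallyRing k e)
    (hz : ∀ p ∈ enBasis (e - 2) i,
      actOn (enBasis (e - 2) (i + 1)) (enEntry (sallyMatrix k e) i) z p = 0) :
    z ∈ boundaries (enBasis (e - 2)) (enEntry (sallyMatrix k e)) (i + 1) :=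
  sally_exact k e he (isBasedComplex_enEntry _) (enBasis_sally_eq_empty e he)
    (fun _ => nullHomotopic_of_mem_minorIdeal _) i z hz

theorem sally_exact_dual (he : 4 ≤ e) (i : ℕ) (z : Finset (Fin (e - 2)) × ℕ → SallyRing k e)
    (hz : ∀ p ∈ dualBasis (e - 2 - 1) (enBasis (e - 2)) i,
      actOn (dualBasis (e - 2 - 1) (enBasis (e - 2)) (i + 1))
        (dualEntry (e - 2 - 1) (enEntry (sallyMatrix k e)) i) z p = 0) :
    z ∈ boundaries (dualBasis (e - 2 - 1) (enBasis (e - 2)))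
      (dualEntry (e - 2 - 1) (enEntry (sallyMatrix k e))) (i + 1) :=
  sally_exact k e he (isBasedComplex_dualEntry _) (dualBasis_sally_eq_empty e he)
    (fun _ => nullHomotopic_dual_of_mem_minorIdeal k e he) i z hz

/-- The coefficients `(-1)^a X_(a+d)`; the map `ψ` is `X_0` times the form with `d = 4` minus
`X_2` times the form with `d = 2`. -/
def shiftCoeff (d a : ℕ) : SallyRing k e := (-1) ^ a * sallyX k e (a + d)

/-- The coefficients of `ψ`. -/
def psiCoeff (a : ℕ) : SallyRing k e :=
  (-1) ^ a * (sallyX k e 0 * sallyX k e (a + 4) - sallyX k e 2 * sallyX k e (a + 2))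

theorem psiCoeff_eq (a : ℕ) : psiCoeff k e a =
    sallyX k e 0 * shiftCoeff k e 4 a - sallyX k e 2 * shiftCoeff k e 2 a := by
  unfold psiCoeff shiftCoeff
  ring

theorem shiftCoeff_relation {d : ℕ} (hd2 : 2 ≤ d) (hd4 : d ≤ 4) (a : ℕ) (ha : a + 2 < e - 2)
    (s : Fin (e - 2)) :
    sallyMatrix k e 0 s * shiftCoeff k e d (a + 1) + sallyMatrix k e 1 s * shiftCoeff k e d a ∈
      minorIdeal (sallyMatrix k e) := by
  have h := Ideal.mul_mem_left _ ((-1) ^ (a + 1))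
    (minor_mem (sallyMatrix k e) s ⟨a + d - 2, by omega⟩)
  rw [sallyMatrix_zero, sallyMatrix_one, sallyMatrix_zero, sallyMatrix_one] at h
  dsimp only at h
  rw [show a + d - 2 + 2 = a + d by omega, show a + d - 2 + 3 = a + 1 + d by omega] at h
  convert h using 1
  rw [sallyMatrix_zero, sallyMatrix_one]
  unfold shiftCoeff
  ring

theorem psiCoeff_relation (a : ℕ) (ha : a + 2 < e - 2) (s : Fin (e - 2)) :
    sallyMatrix k e 0 s * psiCoeff k e (a + 1) + sallyMatrix k e 1 s * psiCoeff k e a ∈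
      minorIdeal (sallyMatrix k e) := by
  have h := sub_mem
    (Ideal.mul_mem_left _ (sallyX k e 0) (shiftCoeff_relation k e (d := 4) (by omega) le_rfl a ha s))
    (Ideal.mul_mem_left _ (sallyX k e 2) (shiftCoeff_relation k e (d := 2) le_rfl (by omega) a ha s))
  convert h using 1
  rw [psiCoeff_eq, psiCoeff_eq]
  ring

/-- The map induced by `ψ` from the zeroth homology of the dual complex to `R ⧸ I₂` is
injective. -/
theorem mem_boundaries_of_psi_mem (he : 4 ≤ e) {z : Finset (Fin (e - 2)) × ℕ → SallyRing k e}
    (hz : dualForm (e - 2) (psiCoeff k e) z ∈ minorIdeal (sallyMatrix k e)) :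
    z ∈ boundaries (dualBasis (e - 2 - 1) (enBasis (e - 2)))
      (dualEntry (e - 2 - 1) (enEntry (sallyMatrix k e))) 0 := by
  have h2 : (2 : ℕ) < e ∧ (2 : ℕ) ≠ 1 := ⟨by omega, by decide⟩
  refine mem_boundaries_of_dualForm_mem _ (by omega) (psiCoeff_relation k e) ⟨0, by omega⟩
    (fun z hz => ?_) (fun r hr => ?_) hz
  · refine sally_mem_boundaries_of_smul_mem k e he (isBasedComplex_dualEntry _)
      (dualBasis_sally_eq_empty e he) (fun _ => nullHomotopic_dual_of_mem_minorIdeal k e he)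
      (c := 3) (by omega) le_rfl ?_
    rw [sallyMatrix_zero] at hz
    rw [sallySeq, if_neg (by dsimp only; omega), ← sallyX_of_lt k e h2]
    exact hz
  · have key : (fun _ => r) ∈ boundaries (enBasis (e - 2)) (enEntry (sallyMatrix k e)) 0 := by
      refine sally_mem_boundaries_of_smul_mem k e he (isBasedComplex_enEntry _)
        (enBasis_sally_eq_empty e he) (fun _ => nullHomotopic_of_mem_minorIdeal _)
        (c := 2) le_rfl (by omega) ?_
      rw [mem_boundaries_zero_iff, Pi.smul_apply, smul_eq_mul]
      have h3 := neg_mem hr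
      convert h3 using 1
      rw [sallySeq, if_pos le_rfl, if_pos rfl, if_pos rfl, ← sallyX_of_lt k e h2, psiCoeff]
      ring
    exact (mem_boundaries_zero_iff _ _).1 key

end SallyHomology

/-! ### Generators of the defining ideal -/

section SallyGenerators

open MvPolynomial

variable (k : Type u) [Field k] (e : ℕ)

/-- The ideal generated by the minors and the image of `ψ`. -/
def sallyRelIdeal : Ideal (SallyRing k e) :=
  minorIdeal (sallyMatrix k e) ⊔ Ideal.span (psiCoeff k e '' {a | a + 4 ≤ e})

theorem sallyMap_sallyX {j : ℕ} (he : 0 < e) (hj : j ≤ e) (h1 : j ≠ 1) :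
    ∃ h : e + j ∈ sallySemigroup e,
      sallyMap k e (sallyX k e j) = AddMonoidAlgebra.single ⟨e + j, h⟩ 1 := by
  rcases hj.lt_or_eq with h | rfl
  · refine ⟨AddSubmonoid.subset_closure ⟨⟨j, h, h1⟩, rfl⟩, ?_⟩
    rw [sallyX_of_lt k e ⟨h, h1⟩, sallyMap, aeval_X]
  · have h0 : j + 0 ∈ sallySemigroup j :=
      AddSubmonoid.subset_closure ⟨⟨0, he, by decide⟩, rfl⟩
    refine ⟨add_mem h0 h0, ?_⟩
    rw [sallyX, dif_neg (by omega), dif_pos ⟨rfl, he⟩, map_pow, sallyMap, aeval_X, pow_two,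
      AddMonoidAlgebra.single_mul_single, one_mul]
    rfl

theorem sallyX_mul_sub_mem {i j a b : ℕ} (he : 0 < e) (hi : i ≤ e) (hi1 : i ≠ 1) (hj : j ≤ e)
    (hj1 : j ≠ 1) (ha : a ≤ e) (ha1 : a ≠ 1) (hb : b ≤ e) (hb1 : b ≠ 1) (h : i + j = a + b) :
    sallyX k e i * sallyX k e j - sallyX k e a * sallyX k e b ∈ sallyIdeal k e := by
  obtain ⟨hi', h2⟩ := sallyMap_sallyX k e he hi hi1
  obtain ⟨hj', h3⟩ := sallyMap_sallyX k e he hj hj1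
  obtain ⟨ha', h4⟩ := sallyMap_sallyX k e he ha ha1
  obtain ⟨hb', h5⟩ := sallyMap_sallyX k e he hb hb1
  rw [sallyIdeal, RingHom.mem_ker, map_sub, map_mul, map_mul, h2, h3, h4, h5,
    AddMonoidAlgebra.single_mul_single, AddMonoidAlgebra.single_mul_single, sub_eq_zero]
  congr 1
  refine Subtype.ext ?_
  change e + i + (e + j) = e + a + (e + b)
  omega

theorem sallyRelIdeal_le (he : 4 ≤ e) : sallyRelIdeal k e ≤ sallyIdeal k e := by
  refine sup_le (Ideal.span_le.2 ?_) (Ideal.span_le.2 ?_)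
  · rintro _ ⟨⟨s, t⟩, rfl⟩
    have hs := s.2
    have ht := t.2
    simp only [sallyMatrix_zero, sallyMatrix_one]
    exact sallyX_mul_sub_mem k e (by omega) (by omega) (by omega) (by omega) (by omega) (by omega)
      (by omega) (by omega) (by omega) (by omega)
  · rintro _ ⟨a, ha, rfl⟩
    have ha' : a + 4 ≤ e := ha
    exact Ideal.mul_mem_left _ _ (sallyX_mul_sub_mem k e (by omega) (by omega) (by omega)
      (by omega) (by omega) (by omega) (by omega) (by omega) (by omega) (by omega))

/-- Monomials of the form `X_0^m`, `X_0^m X_2 X_(e-1)` (for `r = 1`) and `X_0^m X_r` (for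
`2 ≤ r < e`); they represent the elements of the semigroup, listed by their residue `r` mod `e`. -/
def normalForm (m r : ℕ) : SallyRing k e :=
  sallyX k e 0 ^ m *
    (if r = 0 then 1 else if r = 1 then sallyX k e 2 * sallyX k e (e - 1) else sallyX k e r)

theorem sallyX_zero_mul_normalForm (m r : ℕ) :
    sallyX k e 0 * normalForm k e m r = normalForm k e (m + 1) r := by
  rw [normalForm, normalForm, pow_succ']
  ring

/-- The class of a polynomial modulo the minors and the image of `ψ`. -/
abbrev relClass : SallyRing k e →+* SallyRing k e ⧸ sallyRelIdeal k e :=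
  Ideal.Quotient.mk (sallyRelIdeal k e)

theorem sallyX_self (he : 0 < e) : sallyX k e e = sallyX k e 0 ^ 2 := by
  rw [sallyX, dif_neg (by omega), dif_pos ⟨rfl, he⟩, sallyX_of_lt k e ⟨he, by decide⟩]

theorem relClass_psi {a : ℕ} (ha : a + 4 ≤ e) :
    relClass k e (sallyX k e 0 * sallyX k e (a + 4)) =
      relClass k e (sallyX k e 2 * sallyX k e (a + 2)) := by
  rw [Ideal.Quotient.eq]
  have h : psiCoeff k e a ∈ sallyRelIdeal k e :=
    Ideal.mem_sup_right (Ideal.subset_span ⟨a, ha, rfl⟩)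
  have h2 := Ideal.mul_mem_left _ ((-1) ^ a) h
  rwa [psiCoeff, ← mul_assoc, ← mul_pow, neg_one_mul, neg_neg, one_pow, one_mul] at h2

theorem relClass_shift (d : ℕ) : ∀ {i j : ℕ}, 2 ≤ i → i + d ≤ e → 2 ≤ j → j + d ≤ e →
    relClass k e (sallyX k e (i + d) * sallyX k e j) =
      relClass k e (sallyX k e i * sallyX k e (j + d)) := by
  induction d with
  | zero => intros; rfl
  | succ d ih =>
    intro i j hi hid hj hjd
    have h1 : relClass k e (sallyX k e (i + d) * sallyX k e (j + 1)) =
        relClass k e (sallyX k e (i + (d + 1)) * sallyX k e j) := by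
      rw [Ideal.Quotient.eq]
      refine Ideal.mem_sup_left ?_
      have h := minor_mem (sallyMatrix k e) ⟨i + d - 2, by omega⟩ ⟨j - 2, by omega⟩
      simp only [sallyMatrix_zero, sallyMatrix_one] at h
      rw [show i + d - 2 + 2 = i + d by omega, show j - 2 + 3 = j + 1 by omega,
        show j - 2 + 2 = j by omega, show i + d - 2 + 3 = i + (d + 1) by omega,
        mul_comm (sallyX k e j)] at h
      exact h
    rw [← h1, ih hi (by omega) (by omega) (by omega)]
    congr 3
    omega

theorem relClass_mul_eq {i j a b : ℕ} (hi : 2 ≤ i) (hie : i ≤ e) (hj : 2 ≤ j) (hje : j ≤ e)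
    (ha : 2 ≤ a) (hae : a ≤ e) (hb : 2 ≤ b) (hbe : b ≤ e) (h : i + j = a + b) :
    relClass k e (sallyX k e i * sallyX k e j) = relClass k e (sallyX k e a * sallyX k e b) := by
  rcases le_total a i with hai | hai
  · obtain ⟨d, rfl⟩ := Nat.exists_eq_add_of_le hai
    obtain rfl : b = j + d := by omega
    exact relClass_shift k e d ha hie hj hbe
  · obtain ⟨d, rfl⟩ := Nat.exists_eq_add_of_le hai
    obtain rfl : j = b + d := by omega
    exact (relClass_shift k e d hi hae hb hje).symm

/-- The class `y` is represented by a normal form. -/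
def HasNormalForm (y : SallyRing k e ⧸ sallyRelIdeal k e) : Prop :=
  ∃ m, ∃ r < e, y = relClass k e (normalForm k e m r)

variable {k e}

theorem HasNormalForm.zero_mul {y : SallyRing k e ⧸ sallyRelIdeal k e}
    (h : HasNormalForm k e y) : HasNormalForm k e (relClass k e (sallyX k e 0) * y) := by
  obtain ⟨m, r, hr, rfl⟩ := h
  exact ⟨m + 1, r, hr, by rw [← map_mul, sallyX_zero_mul_normalForm]⟩

theorem HasNormalForm.zero_pow_mul {y : SallyRing k e ⧸ sallyRelIdeal k e}
    (h : HasNormalForm k e y) (m : ℕ) :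
    HasNormalForm k e (relClass k e (sallyX k e 0) ^ m * y) := by
  induction m with
  | zero => simpa using h
  | succ m ih => rw [pow_succ', mul_assoc]; exact ih.zero_mul

variable (k e)

theorem hasNormalForm_one (he : 0 < e) : HasNormalForm k e 1 :=
  ⟨0, 0, he, by simp [normalForm]⟩

theorem hasNormalForm_sallyX {i : ℕ} (hi : i < e) (h1 : i ≠ 1) :
    HasNormalForm k e (relClass k e (sallyX k e i)) := by
  rcases Nat.eq_zero_or_pos i with rfl | h0
  · exact ⟨1, 0, hi, by simp [normalForm]⟩
  · exact ⟨0, i, hi, by simp [normalForm, h0.ne', h1]⟩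

theorem hasNormalForm_mul (he : 4 ≤ e) {i j : ℕ} (hi : 2 ≤ i) (hie : i < e) (hj : 2 ≤ j)
    (hje : j < e) : HasNormalForm k e (relClass k e (sallyX k e i * sallyX k e j)) := by
  rcases lt_trichotomy (i + j) (e + 1) with h | h | h
  · obtain ⟨a, ha⟩ := Nat.exists_eq_add_of_le (show 4 ≤ i + j by omega)
    rw [relClass_mul_eq k e (a := 2) (b := a + 2) hi hie.le hj hje.le le_rfl (by omega) (by omega)
      (by omega) (by omega), ← relClass_psi k e (by omega), map_mul]
    refine HasNormalForm.zero_mul ?_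
    rcases (show a + 4 ≤ e by omega).lt_or_eq with h4 | h4
    · exact hasNormalForm_sallyX k e h4 (by omega)
    · rw [h4, sallyX_self k e (by omega), map_pow, ← mul_one (_ ^ 2)]
      exact (hasNormalForm_one k e (by omega)).zero_pow_mul 2
  · rw [relClass_mul_eq k e (a := 2) (b := e - 1) hi hie.le hj hje.le le_rfl (by omega) (by omega)
      (by omega) (by omega)]
    exact ⟨0, 1, by omega, by simp [normalForm]⟩
  · rw [relClass_mul_eq k e (a := e) (b := i + j - e) hi hie.le hj hje.le (by omega) le_rfl
      (by omega) (by omega) (by omega), map_mul, sallyX_self k e (by omega), map_pow]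
    exact (hasNormalForm_sallyX k e (by omega) (by omega)).zero_pow_mul 2

theorem hasNormalForm_mul_mul (he : 4 ≤ e) {i : ℕ} (hi : 2 ≤ i) (hie : i < e) :
    HasNormalForm k e (relClass k e (sallyX k e i * (sallyX k e 2 * sallyX k e (e - 1)))) := by
  rcases hi.lt_or_eq with h | rfl
  · rw [mul_left_comm, map_mul, relClass_mul_eq k e (a := e) (b := i - 1) hi hie.le (by omega)
      (by omega) (by omega) le_rfl (by omega) (by omega) (by omega), map_mul,
      sallyX_self k e (by omega), map_pow, mul_left_comm, ← map_mul]
    exact (hasNormalForm_mul k e he le_rfl (by omega) (by omega) (by omega)).zero_pow_mul 2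
  · rw [← mul_assoc, map_mul, ← relClass_psi k e (a := 0) (by omega), ← map_mul, mul_assoc,
      map_mul, relClass_mul_eq k e (a := e) (b := 3) (by omega) (by omega) (by omega) (by omega)
      (by omega) le_rfl (by omega) (by omega) (by omega), map_mul, sallyX_self k e (by omega),
      map_pow]
    exact ((hasNormalForm_sallyX k e (by omega) (by omega)).zero_pow_mul 2).zero_mul

theorem HasNormalForm.sallyX_mul (he : 4 ≤ e) {i : ℕ} (hie : i < e) (h1 : i ≠ 1)
    {y : SallyRing k e ⧸ sallyRelIdeal k e} (h : HasNormalForm k e y) :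
    HasNormalForm k e (relClass k e (sallyX k e i) * y) := by
  rcases Nat.eq_zero_or_pos i with rfl | h0
  · exact h.zero_mul
  obtain ⟨m, r, hr, rfl⟩ := h
  rw [normalForm, map_mul, map_pow, mul_left_comm, ← map_mul]
  refine HasNormalForm.zero_pow_mul ?_ m
  split_ifs with hr0 hr1
  · rw [mul_one]
    exact hasNormalForm_sallyX k e hie h1
  · exact hasNormalForm_mul_mul k e he (by omega) hie
  · exact hasNormalForm_mul k e he (by omega) hie (by omega) hr

theorem hasNormalForm_monomial (he : 4 ≤ e) (α : SallyIdx e →₀ ℕ) :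
    HasNormalForm k e (relClass k e (monomial α 1)) := by
  suffices h : ∀ y, HasNormalForm k e y → HasNormalForm k e (relClass k e (monomial α 1) * y) by
    simpa using h 1 (hasNormalForm_one k e (by omega))
  rw [monomial_eq, C_1, one_mul]
  refine Finset.prod_induction _
    (fun p => ∀ y, HasNormalForm k e y → HasNormalForm k e (relClass k e p * y))
    (fun p q hp hq y hy => ?_) (fun y hy => ?_) (fun i _ => ?_)
  · rw [map_mul, mul_assoc]
    exact hp _ (hq _ hy)
  · rwa [map_one, one_mul]
  · intro y hy
    dsimp only
    induction α i with
    | zero => simpa using hy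
    | succ j ih =>
      rw [pow_succ', map_mul, mul_assoc, ← sallyX_of_lt k e i.2]
      rw [← sallyX_of_lt k e i.2] at ih
      exact ih.sallyX_mul k e he i.2.1 i.2.2

/-- The degree of a normal form. -/
def normalFormDegree (m r : ℕ) : ℕ :=
  e * m + if r = 0 then 0 else if r = 1 then 3 * e + 1 else e + r

theorem normalFormDegree_injective (he : 4 ≤ e) :
    Function.Injective fun c : ℕ × Fin e => normalFormDegree e c.1 c.2 := by
  have hmod : ∀ m r, r < e → normalFormDegree e m r % e = r := by
    intro m r hr
    unfold normalFormDegree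
    split_ifs with h0 h1
    · simp [h0]
    · rw [h1, Nat.mul_add_mod, Nat.mul_add_mod', Nat.mod_eq_of_lt (by omega)]
    · rw [Nat.mul_add_mod, Nat.add_mod_left, Nat.mod_eq_of_lt hr]
  rintro ⟨m, r⟩ ⟨m', r'⟩ h
  dsimp only at h
  have hr : (r : ℕ) = r' := by rw [← hmod m r r.2, h, hmod m' r' r'.2]
  obtain rfl : r = r' := Fin.ext hr
  have h2 : e * m = e * m' := Nat.add_right_cancel h
  rw [Nat.eq_of_mul_eq_mul_left (by omega) h2]

/-- The evaluation `X_i ↦ t^(e+i)` with values in the polynomial ring. -/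
def sallyEval : SallyRing k e →ₐ[k] Polynomial k :=
  aeval fun i : SallyIdx e => Polynomial.X ^ (e + (i : ℕ))

theorem sallyEval_eq_zero {p : SallyRing k e} (hp : p ∈ sallyIdeal k e) : sallyEval k e p = 0 := by
  have h : sallyEval k e = (AddMonoidAlgebra.lift k (Polynomial k) (sallySemigroup e)
      ⟨⟨fun s => Polynomial.X ^ (s.toAdd : ℕ), by simp⟩, fun s t => by simp [pow_add]⟩).comp
      (sallyMap k e) := by
    refine algHom_ext fun i => ?_
    rw [AlgHom.comp_apply, sallyMap, aeval_X, sallyEval, aeval_X, AddMonoidAlgebra.lift_single,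
      one_smul]
    rfl
  rw [h, AlgHom.comp_apply, show sallyMap k e p = 0 from hp, map_zero]

theorem sallyEval_sallyX {i : ℕ} (hi : i < e) (h1 : i ≠ 1) :
    sallyEval k e (sallyX k e i) = Polynomial.X ^ (e + i) := by
  rw [sallyX_of_lt k e ⟨hi, h1⟩, sallyEval, aeval_X]

theorem sallyEval_normalForm (he : 4 ≤ e) (m : ℕ) {r : ℕ} (hr : r < e) :
    sallyEval k e (normalForm k e m r) = Polynomial.X ^ normalFormDegree e m r := by
  rw [normalForm, map_mul, map_pow, sallyEval_sallyX k e (by omega) (by omega), normalFormDegree,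
    add_zero, pow_add _ (e * m), pow_mul]
  congr 1
  split_ifs with h0 h1
  · simp
  · rw [map_mul, sallyEval_sallyX k e (by omega) (by omega),
      sallyEval_sallyX k e (by omega) (by omega), ← pow_add]
    congr 1
    omega
  · exact sallyEval_sallyX k e hr h1

/-- The defining ideal of the semigroup is generated by the minors and the image of `ψ`: normal
forms span the quotient by these elements and have distinct degrees. -/
theorem sallyIdeal_eq (he : 4 ≤ e) : sallyIdeal k e = sallyRelIdeal k e := by
  refine le_antisymm (fun p hp => ?_) (sallyRelIdeal_le k e he)
  set nf : ℕ × Fin e → SallyRing k e := fun c => normalForm k e c.1 c.2 with hnf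
  have hspan : p ∈ Submodule.span k (Set.range nf) ⊔
      (sallyRelIdeal k e).restrictScalars k := by
    rw [← support_sum_monomial_coeff p]
    refine Submodule.sum_mem _ fun α _ => ?_
    rw [← mul_one (coeff α p), ← smul_eq_mul, ← smul_monomial]
    refine Submodule.smul_mem _ _ ?_
    obtain ⟨m, r, hr, h⟩ := hasNormalForm_monomial k e he α
    rw [Ideal.Quotient.eq] at h
    exact Submodule.mem_sup.2 ⟨nf (m, ⟨r, hr⟩), Submodule.subset_span ⟨_, rfl⟩, _, h,
      add_sub_cancel _ _⟩
  obtain ⟨v, hv, j, hj, rfl⟩ := Submodule.mem_sup.1 hspan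
  have hj' : j ∈ sallyRelIdeal k e := hj
  have hv0 : sallyEval k e v = 0 := by
    have h := sallyEval_eq_zero k e hp
    rwa [map_add, sallyEval_eq_zero k e (sallyRelIdeal_le k e he hj'), add_zero] at h
  obtain ⟨c, rfl⟩ := (Finsupp.mem_span_range_iff_exists_finsupp).1 hv
  have hli : LinearIndependent k fun c : ℕ × Fin e =>
      (Polynomial.X : Polynomial k) ^ normalFormDegree e c.1 c.2 := by
    have h := (Polynomial.basisMonomials k).linearIndependent.comp _
      (normalFormDegree_injective e he)
    rw [Polynomial.coe_basisMonomials] at h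
    convert h using 2
    exact (Polynomial.monomial_one_right_eq_X_pow _).symm
  have hc : c = 0 := by
    refine linearIndependent_iff.1 hli c ?_
    rw [Finsupp.linearCombination_apply, ← hv0, map_finsuppSum]
    refine Finsupp.sum_congr fun x _ => ?_
    rw [map_smul, hnf, sallyEval_normalForm k e he _ x.2.2]
  rw [hc, Finsupp.sum_zero_index, zero_add]
  exact hj'

end SallyGenerators

/-! ### Chain maps out of projective complexes into exact ones -/

section Comparison

variable {R : Type u} [CommRing R]

theorem exactAt_succ_iff (C : ChainComplex (ModuleCat.{u} R) ℕ) (i : ℕ) :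
    C.ExactAt (i + 1) ↔ ∀ x : C.X (i + 1), C.d (i + 1) i x = 0 → ∃ y, C.d (i + 2) (i + 1) y = x := by
  rw [C.exactAt_iff' (i + 2) (i + 1) i (by simp) (by simp), ShortComplex.moduleCat_exact_iff]
  rfl

variable {P Q : ChainComplex (ModuleCat.{u} R) ℕ}

/-- A morphism from a projective object to a term of an exact complex lifts along the differential
if it is a cycle. -/
theorem exists_lift_of_exactAt {X : ModuleCat.{u} R} [Projective X] {i : ℕ}
    (hQ : Q.ExactAt (i + 1)) (f : X ⟶ Q.X (i + 1)) (hf : f ≫ Q.d (i + 1) i = 0) :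
    ∃ g : X ⟶ Q.X (i + 2), g ≫ Q.d (i + 2) (i + 1) = f := by
  rw [Q.exactAt_iff' (i + 2) (i + 1) i (by simp) (by simp)] at hQ
  exact ⟨hQ.liftFromProjective f hf, hQ.liftFromProjective_comp f hf⟩

/-- Existence part of the comparison theorem. -/
theorem exists_chainMap (hP : ∀ i, Projective (P.X i)) (hQ : ∀ i, Q.ExactAt (i + 1))
    (f₀ : P.X 0 ⟶ Q.X 0) (hf : ∃ f₁ : P.X 1 ⟶ Q.X 1, f₁ ≫ Q.d 1 0 = P.d 1 0 ≫ f₀) :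
    ∃ Φ : P ⟶ Q, Φ.f 0 = f₀ := by
  obtain ⟨f₁, hf₁⟩ := hf
  have step : ∀ (n : ℕ) (p : Σ' (f : P.X n ⟶ Q.X n) (f' : P.X (n + 1) ⟶ Q.X (n + 1)),
      f' ≫ Q.d (n + 1) n = P.d (n + 1) n ≫ f),
      ∃ f'' : P.X (n + 2) ⟶ Q.X (n + 2),
        f'' ≫ Q.d (n + 2) (n + 1) = P.d (n + 2) (n + 1) ≫ p.2.1 := by
    intro n p
    refine exists_lift_of_exactAt (hQ n) _ ?_
    rw [Category.assoc, p.2.2, ← Category.assoc, P.d_comp_d, Limits.zero_comp]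
  choose s hs using step
  exact ⟨ChainComplex.mkHom P Q f₀ f₁ hf₁ fun n p => ⟨s n p, hs n p⟩, rfl⟩

/-- Uniqueness part of the comparison theorem: a chain map vanishing in degree `0` is null-homotopic
in each degree. -/
theorem exists_homotopy_succ (hP : ∀ i, Projective (P.X i)) (hQ : ∀ i, Q.ExactAt (i + 1))
    (Φ : P ⟶ Q) (h0 : Φ.f 0 = 0) (i : ℕ) :
    ∃ (g : P.X i ⟶ Q.X (i + 1)) (g' : P.X (i + 1) ⟶ Q.X (i + 2)),
      Φ.f (i + 1) = P.d (i + 1) i ≫ g + g' ≫ Q.d (i + 2) (i + 1) := by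
  induction i with
  | zero =>
    obtain ⟨g', hg'⟩ := exists_lift_of_exactAt (hQ 0) (Φ.f 1) (by
      rw [Φ.comm, h0, Limits.comp_zero])
    exact ⟨0, g', by rw [Limits.comp_zero]; exact ((zero_add _).trans hg').symm⟩
  | succ i ih =>
    obtain ⟨g, g', h⟩ := ih
    obtain ⟨g'', hg''⟩ := exists_lift_of_exactAt (hQ (i + 1))
      (Φ.f (i + 2) - P.d (i + 2) (i + 1) ≫ g') (by
        rw [Preadditive.sub_comp, Φ.comm, h, Preadditive.comp_add, ← Category.assoc (P.d _ _),
          P.d_comp_d, Limits.zero_comp, zero_add, Category.assoc, sub_self])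
    exact ⟨g', g'', by rw [hg'']; abel⟩

/-- The image of the morphism lies in `m` times its target. -/
def ImageIn (m : Ideal R) {X Y : ModuleCat.{u} R} (f : X ⟶ Y) : Prop :=
  LinearMap.range f.hom ≤ m • (⊤ : Submodule R Y)

variable {m : Ideal R}

theorem imageIn_iff {X Y : ModuleCat.{u} R} {f : X ⟶ Y} :
    ImageIn m f ↔ ∀ x, f x ∈ m • (⊤ : Submodule R Y) :=
  ⟨fun h x => h ⟨x, rfl⟩, fun h => by rintro _ ⟨x, rfl⟩; exact h x⟩

theorem apply_mem_smul_top {X Y : ModuleCat.{u} R} (f : X ⟶ Y) {x : X}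
    (hx : x ∈ m • (⊤ : Submodule R X)) : f x ∈ m • (⊤ : Submodule R Y) := by
  have h : (m • (⊤ : Submodule R X)).map f.hom ≤ m • (⊤ : Submodule R Y) := by
    rw [Submodule.map_smul'']
    exact Submodule.smul_mono le_rfl le_top
  exact h ⟨x, hx, rfl⟩

theorem ImageIn.comp_right {X Y Z : ModuleCat.{u} R} {f : X ⟶ Y} (hf : ImageIn m f) (g : Y ⟶ Z) :
    ImageIn m (f ≫ g) :=
  imageIn_iff.2 fun x => apply_mem_smul_top g (imageIn_iff.1 hf x)

theorem ImageIn.comp_left {X Y Z : ModuleCat.{u} R} {g : Y ⟶ Z} (hg : ImageIn m g) (f : X ⟶ Y) :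
    ImageIn m (f ≫ g) :=
  imageIn_iff.2 fun x => imageIn_iff.1 hg (f x)

theorem ImageIn.add {X Y : ModuleCat.{u} R} {f g : X ⟶ Y} (hf : ImageIn m f) (hg : ImageIn m g) :
    ImageIn m (f + g) :=
  imageIn_iff.2 fun x => add_mem (imageIn_iff.1 hf x) (imageIn_iff.1 hg x)

theorem ImageIn.neg {X Y : ModuleCat.{u} R} {f : X ⟶ Y} (hf : ImageIn m f) : ImageIn m (-f) :=
  imageIn_iff.2 fun x => neg_mem (imageIn_iff.1 hf x)

theorem imageIn_smul {X Y : ModuleCat.{u} R} {c : R} (hc : c ∈ m) (f : X ⟶ Y) :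
    ImageIn m (c • f) :=
  imageIn_iff.2 fun _ => Submodule.smul_mem_smul hc Submodule.mem_top

/-- Two chain maps into an exact complex that agree in degree `0` agree modulo `m`, if the
differentials vanish modulo `m`. -/
theorem ImageIn.of_f_zero_eq (hP : ∀ i, Projective (P.X i)) (hQ : ∀ i, Q.ExactAt (i + 1))
    (hPm : ∀ i, ImageIn m (P.d (i + 1) i)) (hQm : ∀ i, ImageIn m (Q.d (i + 1) i))
    {Φ Ψ : P ⟶ Q} (h0 : Φ.f 0 = Ψ.f 0) (hΨ : ∀ i, ImageIn m (Ψ.f i)) (i : ℕ) :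
    ImageIn m (Φ.f i) := by
  have h : ImageIn m ((Φ - Ψ).f i) := by
    have h00 : (Φ - Ψ).f 0 = 0 := by rw [HomologicalComplex.sub_f_apply, h0, sub_self]
    cases i with
    | zero =>
      rw [h00, imageIn_iff]
      exact fun x => zero_mem _
    | succ i =>
      obtain ⟨g, g', hg⟩ := exists_homotopy_succ hP hQ (Φ - Ψ) h00 i
      rw [hg]
      exact ((hPm i).comp_right g).add ((hQm (i + 1)).comp_left g')
  have h2 := h.add (hΨ i)
  rwa [HomologicalComplex.sub_f_apply, sub_add_cancel] at h2

end Comparison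

/-! ### The mapping cone -/

section Cone

open HomologicalComplex

variable {R : Type u} [CommRing R] {F G : ChainComplex (ModuleCat.{u} R) ℕ} (φ : F ⟶ G)

theorem rel_succ (i : ℕ) : (ComplexShape.down ℕ).Rel (i + 1) i := rfl

theorem cone_decomp (i : ℕ) (x : (homotopyCofiber φ).X (i + 1)) :
    homotopyCofiber.inlX φ i (i + 1) (rel_succ i)
        (homotopyCofiber.fstX φ (i + 1) i (rel_succ i) x) +
      homotopyCofiber.inrX φ (i + 1) (homotopyCofiber.sndX φ (i + 1) x) = x := by
  have h : homotopyCofiber.fstX φ (i + 1) i (rel_succ i) ≫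
      homotopyCofiber.inlX φ i (i + 1) (rel_succ i) +
      homotopyCofiber.sndX φ (i + 1) ≫ homotopyCofiber.inrX φ (i + 1) = 𝟙 _ := by
    refine homotopyCofiber.ext_to_X φ _ _ (rel_succ i) ?_ ?_
    · simp
    · simp
  exact ConcreteCategory.congr_hom h x

theorem cone_ext (i : ℕ) {x y : (homotopyCofiber φ).X (i + 1)}
    (h1 : homotopyCofiber.fstX φ (i + 1) i (rel_succ i) x =
      homotopyCofiber.fstX φ (i + 1) i (rel_succ i) y)
    (h2 : homotopyCofiber.sndX φ (i + 1) x = homotopyCofiber.sndX φ (i + 1) y) : x = y := by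
  rw [← cone_decomp φ i x, ← cone_decomp φ i y, h1, h2]

/-- In positive degree the cone is the direct sum of its two constituents. -/
def coneEquiv (i : ℕ) : (homotopyCofiber φ).X (i + 1) ≃ₗ[R] F.X i × G.X (i + 1) where
  toFun x := (homotopyCofiber.fstX φ (i + 1) i (rel_succ i) x, homotopyCofiber.sndX φ (i + 1) x)
  map_add' x y := by simp
  map_smul' c x := by simp
  invFun p := homotopyCofiber.inlX φ i (i + 1) (rel_succ i) p.1 +
    homotopyCofiber.inrX φ (i + 1) p.2
  left_inv x := cone_decomp φ i x
  right_inv p := by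
    have h1 := ConcreteCategory.congr_hom (homotopyCofiber.inlX_fstX φ i (i + 1) (rel_succ i)) p.1
    have h2 := ConcreteCategory.congr_hom (homotopyCofiber.inrX_fstX φ (i + 1) i (rel_succ i)) p.2
    have h3 := ConcreteCategory.congr_hom (homotopyCofiber.inlX_sndX φ i (i + 1) (rel_succ i)) p.1
    have h4 := ConcreteCategory.congr_hom (homotopyCofiber.inrX_sndX φ (i + 1)) p.2
    simp only [ConcreteCategory.comp_apply] at h1 h2 h3 h4
    refine Prod.ext ?_ ?_
    · dsimp only
      rw [map_add, h1, h2]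
      exact add_zero _
    · dsimp only
      rw [map_add, h3, h4]
      exact zero_add _

/-- In degree `0` the cone is the target. -/
def coneZeroEquiv : (homotopyCofiber φ).X 0 ≃ₗ[R] G.X 0 :=
  (homotopyCofiber.XIso φ 0 (by simp)).toLinearEquiv

theorem coneZeroEquiv_apply (x : (homotopyCofiber φ).X 0) :
    coneZeroEquiv φ x = homotopyCofiber.sndX φ 0 x := by
  rw [homotopyCofiber.sndX, dif_neg (by simp)]
  rfl

theorem sndX_d (i : ℕ) (x : (homotopyCofiber φ).X (i + 1)) :
    homotopyCofiber.sndX φ i ((homotopyCofiber φ).d (i + 1) i x) =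
      φ.f i (homotopyCofiber.fstX φ (i + 1) i (rel_succ i) x) +
        G.d (i + 1) i (homotopyCofiber.sndX φ (i + 1) x) :=
  ConcreteCategory.congr_hom (homotopyCofiber.d_sndX φ (i + 1) i (rel_succ i)) x

theorem fstX_d (i : ℕ) (x : (homotopyCofiber φ).X (i + 2)) :
    homotopyCofiber.fstX φ (i + 1) i (rel_succ i) ((homotopyCofiber φ).d (i + 2) (i + 1) x) =
      -F.d (i + 1) i (homotopyCofiber.fstX φ (i + 2) (i + 1) (rel_succ (i + 1)) x) :=
  ConcreteCategory.congr_hom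
    (homotopyCofiber.d_fstX φ (i + 2) (i + 1) i (rel_succ (i + 1)) (rel_succ i)) x

/-- The cone is exact in positive degrees if both complexes are and the induced map on zeroth
homology is injective. -/
theorem cone_exactAt (hF : ∀ i, F.ExactAt (i + 1)) (hG : ∀ i, G.ExactAt (i + 1))
    (hφ : ∀ (a : F.X 0) (b : G.X 1), φ.f 0 a + G.d 1 0 b = 0 → ∃ a', F.d 1 0 a' = a) (i : ℕ) :
    (homotopyCofiber φ).ExactAt (i + 1) := by
  rw [exactAt_succ_iff]
  intro x hx
  set a := homotopyCofiber.fstX φ (i + 1) i (rel_succ i) x with ha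
  set b := homotopyCofiber.sndX φ (i + 1) x with hb
  have h1 : φ.f i a + G.d (i + 1) i b = 0 := by
    rw [ha, hb, ← sndX_d, hx, map_zero]
  obtain ⟨a', ha'⟩ : ∃ a', F.d (i + 1) i a' = a := by
    cases i with
    | zero => exact hφ a b h1
    | succ i =>
      refine (exactAt_succ_iff F i).1 (hF i) a ?_
      have := fstX_d φ i x
      rw [hx, map_zero] at this
      exact neg_eq_zero.1 this.symm
  have hcomm : φ.f i (F.d (i + 1) i a') = G.d (i + 1) i (φ.f (i + 1) a') :=
    (ConcreteCategory.congr_hom (φ.comm (i + 1) i) a').symm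
  obtain ⟨b', hb'⟩ := (exactAt_succ_iff G i).1 (hG i) (b + φ.f (i + 1) a') (by
    rw [map_add, ← hcomm, ha', add_comm, h1])
  refine ⟨(coneEquiv φ (i + 1)).symm (-a', b'), cone_ext φ i ?_ ?_⟩
  · have h := congrArg Prod.fst ((coneEquiv φ (i + 1)).apply_symm_apply (-a', b'))
    rw [fstX_d]
    change homotopyCofiber.fstX φ (i + 2) (i + 1) _ _ = -a' at h
    rw [h, map_neg, neg_neg, ha']
  · have h := congrArg Prod.fst ((coneEquiv φ (i + 1)).apply_symm_apply (-a', b'))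
    have h' := congrArg Prod.snd ((coneEquiv φ (i + 1)).apply_symm_apply (-a', b'))
    rw [sndX_d]
    change homotopyCofiber.fstX φ (i + 2) (i + 1) _ _ = -a' at h
    change homotopyCofiber.sndX φ (i + 2) _ = b' at h'
    rw [h, h', map_neg, hb']
    abel

theorem cone_imageIn {m : Ideal R} (hF : ∀ i, ImageIn m (F.d (i + 1) i))
    (hG : ∀ i, ImageIn m (G.d (i + 1) i)) (hφ : ∀ i, ImageIn m (φ.f i)) (i : ℕ) :
    ImageIn m ((homotopyCofiber φ).d (i + 1) i) := by
  have h2 : ∀ x, homotopyCofiber.inrX φ i (homotopyCofiber.sndX φ i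
      ((homotopyCofiber φ).d (i + 1) i x)) ∈ m • (⊤ : Submodule R ((homotopyCofiber φ).X i)) := by
    intro x
    refine apply_mem_smul_top _ ?_
    rw [sndX_d]
    exact add_mem (imageIn_iff.1 (hφ i) _) (imageIn_iff.1 (hG i) _)
  rw [imageIn_iff]
  intro x
  cases i with
  | zero =>
    have h := ConcreteCategory.congr_hom (homotopyCofiber.sndX_inrX φ 0 (by simp))
      ((homotopyCofiber φ).d 1 0 x)
    have h3 := h2 x
    erw [h] at h3
    exact h3
  | succ i =>
    rw [← cone_decomp φ i ((homotopyCofiber φ).d (i + 2) (i + 1) x)]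
    refine add_mem (apply_mem_smul_top _ ?_) (h2 x)
    rw [fstX_d]
    exact neg_mem (imageIn_iff.1 (hF i) _)

end Cone

/-! ### Betti numbers from a minimal free resolution -/

section Betti

open TensorProduct

variable {R : Type u} [CommRing R]

theorem nonempty_homology_zero_iso (C : ChainComplex (ModuleCat.{u} R) ℕ) {M : ModuleCat.{u} R}
    (π : C.X 0 ⟶ M) (hπ : Function.Surjective π) (h0 : C.d 1 0 ≫ π = 0)
    (hex : ∀ x, π x = 0 → ∃ y, C.d 1 0 y = x) : Nonempty (C.homology 0 ≅ M) := by
  have h : IsIso (C.descOpcycles π 1 (by simp) h0) :=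
    (ChainComplex.isIso_descOpcycles_iff C π h0).2
      ⟨(ShortComplex.moduleCat_exact_iff _).2 hex, (ModuleCat.epi_iff_surjective _).2 hπ⟩
  exact ⟨C.isoHomologyι₀ ≪≫ @asIso _ _ _ _ _ h⟩

variable {m : Ideal R} {C : ChainComplex (ModuleCat.{u} R) ℕ} {M : ModuleCat.{u} R}

/-- A minimal free resolution as a projective resolution. -/
theorem IsMinimalFreeResolution.exists_projectiveResolution
    (h : IsMinimalFreeResolution m C M) : ∃ P : ProjectiveResolution M, P.complex = C := by
  obtain ⟨i⟩ := h.homology_zero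
  set f : C.X 0 ⟶ M := C.pOpcycles 0 ≫ C.isoHomologyι₀.inv ≫ i.hom with hf
  have hd : C.d 1 0 ≫ f = 0 := by rw [hf, ← Category.assoc, C.d_pOpcycles, Limits.zero_comp]
  have hiso : IsIso (C.descOpcycles f 1 (by simp) hd) := by
    have : C.descOpcycles f 1 (by simp) hd = C.isoHomologyι₀.inv ≫ i.hom := by
      rw [← cancel_epi (C.pOpcycles 0), C.p_descOpcycles]
    rw [this]
    infer_instance
  obtain ⟨hex, hepi⟩ := (ChainComplex.isIso_descOpcycles_iff C f hd).1 hiso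
  refine ⟨{ complex := C, projective := fun n => ?_,
            π := (ChainComplex.toSingle₀Equiv C M).symm ⟨f, hd⟩, quasiIso := ⟨fun n => ?_⟩ }, rfl⟩
  · have := h.free n
    exact ModuleCat.projective_of_free (Module.Free.chooseBasis R (C.X n))
  · cases n with
    | zero =>
      rw [ChainComplex.quasiIsoAt₀_iff, ShortComplex.quasiIso_iff_of_zeros']
      · have hz := ChainComplex.toSingle₀Equiv_symm_apply_f_zero f hd
        refine (ShortComplex.exact_and_epi_g_iff_of_iso ?_).2 ⟨hex, hepi⟩
        exact ShortComplex.isoMk (Iso.refl _) (Iso.refl _) (Iso.refl _)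
          ((Category.id_comp _).trans (Category.comp_id _).symm)
          ((Category.id_comp _).trans (hz.symm.trans (Category.comp_id _).symm))
      all_goals first | rfl | exact C.shape 0 0 (by simp)
    | succ n =>
      rw [quasiIsoAt_iff_exactAt']
      · exact h.exactAt (n + 1) (Nat.succ_pos n)
      · exact ChainComplex.exactAt_succ_single_obj _ _

/-- The homology of a complex with zero differentials is the complex itself. -/
theorem nonempty_homology_iso_of_d_eq_zero (K : ChainComplex (ModuleCat.{u} R) ℕ)
    (hK : ∀ i j, K.d i j = 0) (t : ℕ) : Nonempty (K.homology t ≅ K.X t) :=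
  ⟨(ShortComplex.LeftHomologyData.ofZeros (K.sc t) (hK _ _) (hK _ _)).homologyIso⟩

theorem IsMinimalFreeResolution.d_apply_mem (h : IsMinimalFreeResolution m C M) (i j : ℕ)
    (x : C.X i) : C.d i j x ∈ m • (⊤ : Submodule R (C.X j)) := by
  by_cases hij : (ComplexShape.down ℕ).Rel i j
  · obtain rfl : j + 1 = i := hij
    exact h.minimal j ⟨x, rfl⟩
  · rw [C.shape i j hij]
    exact zero_mem _

theorem tmul_eq_zero_of_mem {N : Type u} [AddCommGroup N] [Module R N] (y : R ⧸ m) {x : N}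
    (hx : x ∈ m • (⊤ : Submodule R N)) : y ⊗ₜ[R] x = 0 := by
  refine Submodule.smul_induction_on hx (fun c hc n _ => ?_) (fun a b ha hb => ?_)
  · have : c • y = 0 := by
      obtain ⟨r, rfl⟩ := Ideal.Quotient.mk_surjective y
      rw [Algebra.smul_def]
      change Ideal.Quotient.mk m c * Ideal.Quotient.mk m r = 0
      rw [Ideal.Quotient.eq_zero_iff_mem.2 hc, zero_mul]
    rw [← TensorProduct.smul_tmul, this, TensorProduct.zero_tmul]
  · rw [TensorProduct.tmul_add, ha, hb, add_zero]

/-- The groups `Tor_t(R ⧸ m, M)` are computed by the free modules of a minimal resolution. -/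
theorem IsMinimalFreeResolution.nonempty_tor_iso (h : IsMinimalFreeResolution m C M) (t : ℕ) :
    Nonempty (((Tor (ModuleCat.{u} R) t).obj (ModuleCat.of R (R ⧸ m))).obj M ≅
      ModuleCat.of R ((R ⧸ m) ⊗[R] C.X t)) := by
  obtain ⟨P, rfl⟩ := h.exists_projectiveResolution
  set F := (MonoidalCategory.tensoringLeft (ModuleCat.{u} R)).obj (ModuleCat.of R (R ⧸ m)) with hF
  obtain ⟨i⟩ := nonempty_homology_iso_of_d_eq_zero
    ((F.mapHomologicalComplex _).obj P.complex) (fun i j => by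
      ext x
      change F.map (P.complex.d i j) x = 0
      induction x using TensorProduct.induction_on with
      | zero => exact map_zero _
      | add a b ha hb => rw [map_add, ha, hb, add_zero]
      | tmul y x => exact tmul_eq_zero_of_mem y (h.d_apply_mem i j x)) t
  exact ⟨P.isoLeftDerivedObj F t ≪≫ i⟩

end Betti

section BettiPolynomial

open TensorProduct MvPolynomial

variable {k : Type u} [Field k] {σ : Type}

theorem ker_constantCoeff :
    RingHom.ker (constantCoeff : MvPolynomial σ k →+* k) = idealOfVars σ k := by
  ext p
  rw [RingHom.mem_ker, idealOfVars, ← Set.image_univ, mem_ideal_span_X_image]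
  constructor
  · intro h m hm
    by_contra! hc
    have : m = 0 := Finsupp.ext fun i => hc i (Set.mem_univ i)
    rw [this, mem_support_iff] at hm
    exact hm h
  · intro h
    by_contra hc
    obtain ⟨i, -, hi⟩ := h 0 (mem_support_iff.2 hc)
    exact hi rfl

theorem finrank_restrictScalars_pi (r : ℕ) :
    Module.finrank k ((ModuleCat.restrictScalars (algebraMap k (MvPolynomial σ k))).obj
      (ModuleCat.of (MvPolynomial σ k)
        (Fin r → MvPolynomial σ k ⧸ idealOfVars σ k))) = r := by
  let ε : (MvPolynomial σ k ⧸ idealOfVars σ k) ≃+* k :=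
    (Ideal.quotEquivOfEq ker_constantCoeff.symm).trans
      (RingHom.quotientKerEquivOfSurjective (fun c => ⟨C c, constantCoeff_C σ c⟩))
  let E : ((ModuleCat.restrictScalars (algebraMap k (MvPolynomial σ k))).obj
      (ModuleCat.of (MvPolynomial σ k)
        (Fin r → MvPolynomial σ k ⧸ idealOfVars σ k))) ≃ₗ[k] (Fin r → k) :=
    { toFun := fun v j => ε (v j)
      map_add' := fun v w => funext fun j => map_add ε (v j) (w j)
      map_smul' := fun c v => funext fun j => by
        have h : ε (Ideal.Quotient.mk _ (C c) * v j) = c * ε (v j) := by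
          rw [map_mul]
          congr 1
          exact constantCoeff_C σ c
        exact h
      invFun := fun w j => ε.symm (w j)
      left_inv := fun v => funext fun j => ε.symm_apply_apply (v j)
      right_inv := fun w => funext fun j => ε.apply_symm_apply (w j) }
  rw [E.finrank_eq, Module.finrank_fin_fun]

theorem IsMinimalFreeResolution.bettiNumber_eq {C : ChainComplex (ModuleCat.{u} (MvPolynomial σ k)) ℕ}
    {M : ModuleCat.{u} (MvPolynomial σ k)}
    (h : IsMinimalFreeResolution (idealOfVars σ k) C M) (t : ℕ) :
    bettiNumber k σ M t = Module.finrank (MvPolynomial σ k) (C.X t) := by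
  obtain ⟨i⟩ := h.nonempty_tor_iso t
  have := h.free t
  have := h.finite t
  let b := Module.finBasis (MvPolynomial σ k) (C.X t)
  let e : ((MvPolynomial σ k ⧸ idealOfVars σ k) ⊗[MvPolynomial σ k] C.X t) ≃ₗ[MvPolynomial σ k]
      (Fin (Module.finrank (MvPolynomial σ k) (C.X t)) → MvPolynomial σ k ⧸ idealOfVars σ k) :=
    (TensorProduct.congr (LinearEquiv.refl _ _) b.equivFun).trans
      (TensorProduct.piScalarRight _ _ _ _)
  rw [bettiNumber, ((ModuleCat.restrictScalars (algebraMap k (MvPolynomial σ k))).mapIso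
    (i ≪≫ e.toModuleIso)).toLinearEquiv.finrank_eq]
  exact finrank_restrictScalars_pi _

end BettiPolynomial

/-! ### Coordinates in complexes with chosen bases -/

section Coordinates

variable {R : Type u} [CommRing R] {α : Type} [DecidableEq α]

/-- Extension by zero of a vector indexed by a finite set. -/
def zeroExtend (B : Finset α) (x : B → R) (a : α) : R := if ha : a ∈ B then x ⟨a, ha⟩ else 0

theorem zeroExtend_apply {B : Finset α} (x : B → R) (a : B) : zeroExtend B x a = x a :=
  dif_pos a.2

theorem zeroExtend_restrict {B : Finset α} (z : α → R) {a : α} (ha : a ∈ B) :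
    zeroExtend B (fun b : B => z b) a = z a :=
  dif_pos ha

variable {B : ℕ → Finset α} {D : ℕ → α → α → R}
  {h : ∀ i, ∀ p ∈ B i, ∀ r ∈ B (i + 2), ∑ q ∈ B (i + 1), D i p q * D (i + 1) q r = 0}

theorem toLin'_apply_eq_sum {B B' : Finset α} (M : α → α → R) (x : B' → R) (p : B) :
    Matrix.toLin' (Matrix.of fun (p : B) (q : B') => M p q) x p =
      ∑ q ∈ B', M p q * zeroExtend B' x q := by
  rw [Matrix.toLin'_apply, Matrix.mulVec, dotProduct,
    ← Finset.sum_coe_sort B' fun q => M p q * zeroExtend B' x q]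
  refine Finset.sum_congr rfl fun q _ => ?_
  rw [zeroExtend_apply]
  rfl

theorem basedComplex_d_apply (i : ℕ) (x : B (i + 1) → R) (p : B i) :
    (show B i → R from (basedComplex B D h).d (i + 1) i x) p =
      actOn (B (i + 1)) (D i) (zeroExtend (B (i + 1)) x) p := by
  have hd : (basedComplex B D h).d (i + 1) i = ModuleCat.ofHom
      (Matrix.toLin' (Matrix.of fun (p : B i) (q : B (i + 1)) => D i p q)) :=
    ChainComplex.of_d (fun i => ModuleCat.of R (B i → R)) (fun i => ModuleCat.ofHom
      (Matrix.toLin' (Matrix.of fun (p : B i) (q : B (i + 1)) => D i p q))) i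
  exact (congrFun (ConcreteCategory.congr_hom hd x) p).trans (toLin'_apply_eq_sum (D i) x p)

theorem basedComplex_exists_d_iff (i : ℕ) (x : B i → R) :
    (∃ y, (basedComplex B D h).d (i + 1) i y = x) ↔ zeroExtend (B i) x ∈ boundaries B D i := by
  constructor
  · rintro ⟨y, rfl⟩
    refine ⟨zeroExtend (B (i + 1)) y, fun p hp => ?_⟩
    rw [← basedComplex_d_apply i y ⟨p, hp⟩ (h := h)]
    exact zeroExtend_apply _ (⟨p, hp⟩ : B i)
  · rintro ⟨v, hv⟩
    refine ⟨fun q => v q, funext fun p => ?_⟩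
    refine (basedComplex_d_apply i (fun q : B (i + 1) => v q) p (h := h)).trans ?_
    rw [actOn_congr (D i) (w := v) fun q hq => zeroExtend_restrict v hq, ← hv p p.2,
      zeroExtend_apply]

theorem basedComplex_exactAt {i : ℕ}
    (hex : ∀ z, (∀ p ∈ B i, actOn (B (i + 1)) (D i) z p = 0) → z ∈ boundaries B D (i + 1)) :
    (basedComplex B D h).ExactAt (i + 1) := by
  rw [exactAt_succ_iff]
  intro x hx
  refine (basedComplex_exists_d_iff (i + 1) x).2 (hex _ fun p hp => ?_)
  rw [← basedComplex_d_apply i x ⟨p, hp⟩ (h := h)]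
  exact congrFun hx (⟨p, hp⟩ : B i)

variable (B D h) in
/-- The chosen basis of a term of the complex. -/
def basedComplexBasis (i : ℕ) : Module.Basis (B i) R ((basedComplex B D h).X i) :=
  Pi.basisFun R (B i)

theorem basedComplex_projective (i : ℕ) : Projective ((basedComplex B D h).X i) :=
  ModuleCat.projective_of_free (basedComplexBasis B D h i)

theorem mem_smul_top_pi {ι : Type} [Finite ι] {m : Ideal R} {x : ι → R} (hx : ∀ i, x i ∈ m) :
    x ∈ m • (⊤ : Submodule R (ι → R)) := by
  classical
  have := Fintype.ofFinite ι
  rw [pi_eq_sum_univ' x]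
  exact sum_mem fun i _ => Submodule.smul_mem_smul (hx i) Submodule.mem_top

theorem basedComplex_imageIn {m : Ideal R} {i : ℕ} (hm : ∀ p q, D i p q ∈ m) :
    ImageIn m ((basedComplex B D h).d (i + 1) i) := by
  rw [imageIn_iff]
  intro x
  refine mem_smul_top_pi (ι := B i) fun p => ?_
  refine Eq.mpr (congrArg (· ∈ m) (basedComplex_d_apply i x p (h := h))) ?_
  exact sum_mem fun q _ => Ideal.mul_mem_right _ _ (hm p q)

/-- A morphism out of a projective module lifts along `g` as soon as its image lies in that
of `g`. -/
theorem exists_lift_of_forall_exists {X Y Z : ModuleCat.{u} R} [Module.Projective R X] (f : X ⟶ Z)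
    (g : Y ⟶ Z) (hfg : ∀ x, ∃ y, g y = f x) : ∃ l : X ⟶ Y, l ≫ g = f := by
  obtain ⟨l, hl⟩ := Module.projective_lifting_property g.hom.rangeRestrict
    (f.hom.codRestrict (LinearMap.range g.hom) hfg) g.hom.surjective_rangeRestrict
  refine ⟨ModuleCat.ofHom l, ?_⟩
  ext x
  exact congrArg Subtype.val (LinearMap.congr_fun hl x)

end Coordinates

section EagonNorthcott

variable {R : Type u} [CommRing R] {n : ℕ} (A : Matrix (Fin 2) (Fin n) R)

theorem enEntry_mem {m : Ideal R} (hA : ∀ r s, A r s ∈ m) (i : ℕ) (p q : Finset (Fin n) × ℕ) :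
    enEntry A i p q ∈ m := by
  unfold enEntry
  by_cases hi : i = 0
  · rw [if_pos hi]
    refine sum_mem fun s _ => sum_mem fun t _ => ?_
    split_ifs
    · exact sub_mem (Ideal.mul_mem_right _ _ (hA 0 s)) (Ideal.mul_mem_right _ _ (hA 0 t))
    · exact zero_mem _
  · rw [if_neg hi]
    refine sum_mem fun s _ => ?_
    split_ifs
    all_goals first
      | exact zero_mem _
      | refine Ideal.mul_mem_left _ _ (add_mem ?_ ?_) <;> first | exact hA _ _ | exact zero_mem _

theorem eagonNorthcott_imageIn {m : Ideal R} (hA : ∀ r s, A r s ∈ m) (i : ℕ) :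
    ImageIn m ((eagonNorthcott A).d (i + 1) i) :=
  basedComplex_imageIn (enEntry_mem A hA i)

theorem eagonNorthcottDual_imageIn {m : Ideal R} (hA : ∀ r s, A r s ∈ m) (i : ℕ) :
    ImageIn m ((eagonNorthcottDual A).d (i + 1) i) :=
  basedComplex_imageIn fun p q => enEntry_mem A hA _ q p

theorem card_enBasis_succ (i : ℕ) :
    (enBasis n (i + 1)).card = n.choose (i + 2) * (i + 1) := by
  rw [enBasis, if_neg (Nat.succ_ne_zero i), Finset.card_product, Finset.card_powersetCard,
    Finset.card_univ, Fintype.card_fin, Finset.card_range]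

/-- The generator of degree `0` of the Eagon–Northcott complex. -/
def enBasisZero (n : ℕ) : enBasis n 0 := ⟨(∅, 0), Finset.mem_singleton_self _⟩

theorem eq_enBasisZero (p : enBasis n 0) : p = enBasisZero n :=
  Subtype.ext (Finset.mem_singleton.1 p.2)

theorem eagonNorthcott_exists_d_iff (x : enBasis n 0 → R) :
    (∃ y, (eagonNorthcott A).d 1 0 y = x) ↔ x (enBasisZero n) ∈ minorIdeal A := by
  refine (basedComplex_exists_d_iff 0 x).trans ((mem_boundaries_zero_iff A _).trans ?_)
  rw [← zeroExtend_apply x (enBasisZero n)]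
  rfl

/-- The morphism from degree `0` of the dual complex to `R` with value `c a` on
`g₁^a g₂^(n-2-a)`. -/
def formMap (c : ℕ → R) : (eagonNorthcottDual A).X 0 ⟶ (eagonNorthcott A).X 0 :=
  ModuleCat.ofHom (Matrix.toLin' (Matrix.of
    fun (_ : enBasis n 0) (q : dualBasis (n - 1) (enBasis n) 0) => c q.1.2))

theorem formMap_apply (c : ℕ → R) (x : dualBasis (n - 1) (enBasis n) 0 → R) (p : enBasis n 0) :
    (show enBasis n 0 → R from formMap A c x) p =
      dualForm n c (zeroExtend (dualBasis (n - 1) (enBasis n) 0) x) := by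
  rw [dualForm_apply]
  exact toLin'_apply_eq_sum (fun _ q : Finset (Fin n) × ℕ => c q.2) x p

/-- A linear form respecting the relations modulo the minors is the degree `0` part of a chain
map. -/
theorem exists_chainMap_formMap (hn : 2 ≤ n) (hA : ∀ i, (eagonNorthcott A).ExactAt (i + 1))
    {c : ℕ → R} (hc : ∀ a, a + 2 < n → ∀ s, A 0 s * c (a + 1) + A 1 s * c a ∈ minorIdeal A) :
    ∃ Φ : eagonNorthcottDual A ⟶ eagonNorthcott A, Φ.f 0 = formMap A c := by
  refine exists_chainMap (P := eagonNorthcottDual A) (fun i => basedComplex_projective i) hA _ ?_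
  have : Module.Projective R ((eagonNorthcottDual A).X 1) :=
    Module.Projective.of_basis (basedComplexBasis _ _ (isBasedComplex_dualEntry A) 1)
  refine exists_lift_of_forall_exists _ _ fun x => (eagonNorthcott_exists_d_iff A _).2 ?_
  refine Eq.mpr ?_ (dualForm_mem_minorIdeal hn hc
    ((basedComplex_exists_d_iff 0 ((eagonNorthcottDual A).d 1 0 x)).1 ⟨x, rfl⟩))
  exact congrArg (· ∈ minorIdeal A) (formMap_apply A c _ _)

/-- The values of the linear form are the combinations of its coefficients. -/
theorem exists_dualForm_eq (hn : 2 ≤ n) (c : ℕ → R) {r : R}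
    (hr : r ∈ Ideal.span (c '' {a | a + 2 ≤ n})) : ∃ z, dualForm n c z = r := by
  have hle : Ideal.span (c '' {a | a + 2 ≤ n}) ≤ LinearMap.range (dualForm n c) := by
    refine Submodule.span_le.2 ?_
    rintro _ ⟨a, ha, rfl⟩
    have hm : ((Finset.univ, a) : Finset (Fin n) × ℕ) ∈ dualBasis (n - 1) (enBasis n) 0 := by
      rw [mem_dualBasis_zero hn]
      have : a + 2 ≤ n := ha
      exact ⟨rfl, by dsimp only; omega⟩
    refine ⟨Pi.single (Finset.univ, a) 1, ?_⟩
    rw [dualForm_apply, Finset.sum_eq_single_of_mem _ hm fun q _ hq => by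
      rw [Pi.single_eq_of_ne hq, mul_zero]]
    rw [Pi.single_eq_same, mul_one]
  exact hle hr

theorem dualForm_mem_span (hn : 2 ≤ n) (c : ℕ → R) (z : Finset (Fin n) × ℕ → R) :
    dualForm n c z ∈ Ideal.span (c '' {a | a + 2 ≤ n}) := by
  rw [dualForm_apply]
  refine sum_mem fun q hq => Ideal.mul_mem_right _ _ (Ideal.subset_span ⟨q.2, ?_, rfl⟩)
  have := ((mem_dualBasis_zero hn).1 hq).2
  change q.2 + 2 ≤ n
  omega

theorem dualForm_zeroExtend (c : ℕ → R) (z : Finset (Fin n) × ℕ → R) :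
    dualForm n c (zeroExtend (dualBasis (n - 1) (enBasis n) 0) fun q => z q) = dualForm n c z := by
  rw [dualForm_apply, dualForm_apply]
  exact Finset.sum_congr rfl fun q hq => by rw [zeroExtend_restrict z hq]

end EagonNorthcott

/-! ### The mapping cone of `ψ` -/

section SallyCone

open MvPolynomial HomologicalComplex

variable (k : Type u) [Field k] (e : ℕ)

theorem sallyX_mem_idealOfVars (i : ℕ) : sallyX k e i ∈ idealOfVars (SallyIdx e) k := by
  unfold sallyX
  split_ifs
  · exact Ideal.subset_span ⟨_, rfl⟩
  · exact Ideal.pow_mem_of_mem _ (Ideal.subset_span (Set.mem_range_self _)) 2 two_pos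
  · exact zero_mem _

theorem sallyMatrix_mem_idealOfVars (r : Fin 2) (s : Fin (e - 2)) :
    sallyMatrix k e r s ∈ idealOfVars (SallyIdx e) k :=
  sallyX_mem_idealOfVars k e _

theorem eagonNorthcott_sally_exactAt (he : 4 ≤ e) (i : ℕ) :
    (eagonNorthcott (sallyMatrix k e)).ExactAt (i + 1) :=
  basedComplex_exactAt (sally_exact_en k e he i)

theorem eagonNorthcottDual_sally_exactAt (he : 4 ≤ e) (i : ℕ) :
    (eagonNorthcottDual (sallyMatrix k e)).ExactAt (i + 1) :=
  basedComplex_exactAt (sally_exact_dual k e he i)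

theorem sallyPsi_eq_formMap : sallyPsi k e = formMap (sallyMatrix k e) (psiCoeff k e) := rfl

/-- Some extension of `ψ` vanishes modulo the variables: `X_0` times an extension of the form with
coefficients `(-1)^a X_(a+4)` minus `X_2` times one of the form with coefficients
`(-1)^a X_(a+2)`. -/
theorem exists_chainMap_sallyPsi (he : 4 ≤ e) :
    ∃ Ψ : eagonNorthcottDual (sallyMatrix k e) ⟶ eagonNorthcott (sallyMatrix k e),
      Ψ.f 0 = sallyPsi k e ∧ ∀ i, ImageIn (idealOfVars (SallyIdx e) k) (Ψ.f i) := by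
  obtain ⟨Φ₄, h₄⟩ := exists_chainMap_formMap (sallyMatrix k e) (by omega)
    (eagonNorthcott_sally_exactAt k e he) (shiftCoeff_relation k e (d := 4) (by omega) le_rfl)
  obtain ⟨Φ₂, h₂⟩ := exists_chainMap_formMap (sallyMatrix k e) (by omega)
    (eagonNorthcott_sally_exactAt k e he) (shiftCoeff_relation k e (d := 2) le_rfl (by omega))
  refine ⟨sallyX k e 0 • Φ₄ + -(sallyX k e 2 • Φ₂), ?_, fun i => ?_⟩
  · rw [add_f_apply, neg_f_apply, smul_f_apply, smul_f_apply, h₄, h₂, sallyPsi_eq_formMap]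
    ext x
    funext p
    have hx : ∀ c, (show enBasis (e - 2) 0 → SallyRing k e from
        formMap (sallyMatrix k e) c x) p = _ := fun c => formMap_apply (sallyMatrix k e) c x p
    change sallyX k e 0 * (show enBasis (e - 2) 0 → SallyRing k e from
        formMap (sallyMatrix k e) (shiftCoeff k e 4) x) p +
      -(sallyX k e 2 * (show enBasis (e - 2) 0 → SallyRing k e from
        formMap (sallyMatrix k e) (shiftCoeff k e 2) x) p) = (show enBasis (e - 2) 0 → SallyRing k e
          from formMap (sallyMatrix k e) (psiCoeff k e) x) p
    rw [hx, hx, hx, dualForm_apply, dualForm_apply, dualForm_apply, ← sub_eq_add_neg,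
      Finset.mul_sum, Finset.mul_sum, ← Finset.sum_sub_distrib]
    refine Finset.sum_congr rfl fun q _ => ?_
    rw [psiCoeff_eq]
    ring
  · rw [add_f_apply, neg_f_apply, smul_f_apply, smul_f_apply]
    exact (imageIn_smul (sallyX_mem_idealOfVars k e 0) _).add
      (imageIn_smul (sallyX_mem_idealOfVars k e 2) _).neg

variable {k e}

theorem apply_enBasisZero_mem (b : (eagonNorthcott (sallyMatrix k e)).X 1) :
    (show enBasis (e - 2) 0 → SallyRing k e from
      (eagonNorthcott (sallyMatrix k e)).d 1 0 b) (enBasisZero (e - 2)) ∈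
      minorIdeal (sallyMatrix k e) :=
  (eagonNorthcott_exists_d_iff (sallyMatrix k e) _).1 ⟨b, rfl⟩

variable {Ψ : eagonNorthcottDual (sallyMatrix k e) ⟶ eagonNorthcott (sallyMatrix k e)}

theorem f_zero_apply (hΨ : Ψ.f 0 = sallyPsi k e)
    (a : dualBasis (e - 2 - 1) (enBasis (e - 2)) 0 → SallyRing k e) :
    (show enBasis (e - 2) 0 → SallyRing k e from Ψ.f 0 a) (enBasisZero (e - 2)) =
      dualForm (e - 2) (psiCoeff k e) (zeroExtend (dualBasis (e - 2 - 1) (enBasis (e - 2)) 0) a) := by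
  rw [hΨ, sallyPsi_eq_formMap]
  exact formMap_apply (sallyMatrix k e) (psiCoeff k e) a _

theorem sally_cone_exactAt (he : 4 ≤ e) (hΨ : Ψ.f 0 = sallyPsi k e) (i : ℕ) :
    (homotopyCofiber Ψ).ExactAt (i + 1) := by
  refine cone_exactAt Ψ (eagonNorthcottDual_sally_exactAt k e he)
    (eagonNorthcott_sally_exactAt k e he) (fun a b hab => ?_) i
  refine (basedComplex_exists_d_iff 0 a).2 (mem_boundaries_of_psi_mem k e he ?_)
  rw [← f_zero_apply hΨ a]
  have h1 := congrFun (show (show enBasis (e - 2) 0 → SallyRing k e from Ψ.f 0 a) +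
    (show enBasis (e - 2) 0 → SallyRing k e from
      (eagonNorthcott (sallyMatrix k e)).d 1 0 b) = 0 from hab) (enBasisZero (e - 2))
  rw [eq_neg_of_add_eq_zero_left h1]
  exact neg_mem (apply_enBasisZero_mem b)

theorem sally_cone_homology_zero (he : 4 ≤ e) (hΨ : Ψ.f 0 = sallyPsi k e) :
    Nonempty ((homotopyCofiber Ψ).homology 0 ≅
      ModuleCat.of (SallyRing k e) (SallyRing k e ⧸ sallyIdeal k e)) := by
  have hset : {a | a + 4 ≤ e} = {a | a + 2 ≤ e - 2} := by
    ext a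
    change a + 4 ≤ e ↔ a + 2 ≤ e - 2
    omega
  let ev : (eagonNorthcott (sallyMatrix k e)).X 0 →ₗ[SallyRing k e] SallyRing k e :=
    LinearMap.proj (R := SallyRing k e) (φ := fun _ : enBasis (e - 2) 0 => SallyRing k e)
      (enBasisZero (e - 2))
  let π : (homotopyCofiber Ψ).X 0 →ₗ[SallyRing k e] (SallyRing k e ⧸ sallyIdeal k e) :=
    (Submodule.mkQ (sallyIdeal k e)) ∘ₗ ev ∘ₗ (coneZeroEquiv Ψ).toLinearMap
  have hπ : ∀ x, π x = 0 ↔ ev (coneZeroEquiv Ψ x) ∈ sallyRelIdeal k e := by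
    intro x
    rw [← sallyIdeal_eq k e he]
    exact Submodule.Quotient.mk_eq_zero _
  have hd : ∀ y, coneZeroEquiv Ψ ((homotopyCofiber Ψ).d 1 0 y) =
      Ψ.f 0 (homotopyCofiber.fstX Ψ 1 0 (rel_succ 0) y) +
        (eagonNorthcott (sallyMatrix k e)).d 1 0 (homotopyCofiber.sndX Ψ 1 y) := fun y => by
    rw [coneZeroEquiv_apply, sndX_d]
  refine nonempty_homology_zero_iso _ (ModuleCat.ofHom π) ?_ ?_ ?_
  · intro y
    obtain ⟨r, rfl⟩ := Submodule.mkQ_surjective _ y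
    refine ⟨(coneZeroEquiv Ψ).symm fun _ => r, ?_⟩
    exact congrArg (fun v => Submodule.mkQ (sallyIdeal k e) (ev v))
      (LinearEquiv.apply_symm_apply (coneZeroEquiv Ψ) fun _ => r)
  · refine ModuleCat.hom_ext (LinearMap.ext fun y => (hπ _).2 ?_)
    refine Eq.mpr (congrArg (fun v => ev v ∈ sallyRelIdeal k e) (hd y)) ?_
    rw [map_add]
    refine add_mem ?_ (Ideal.mem_sup_left (apply_enBasisZero_mem _))
    refine Ideal.mem_sup_right ?_
    rw [hset]
    exact Eq.mpr (congrArg (· ∈ Ideal.span (psiCoeff k e '' {a | a + 2 ≤ e - 2}))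
      (f_zero_apply hΨ (homotopyCofiber.fstX Ψ 1 0 (rel_succ 0) y)))
      (dualForm_mem_span (n := e - 2) (by omega) (psiCoeff k e) _)
  · intro x hx
    obtain ⟨r, hr, s, hs, hrs⟩ := Submodule.mem_sup.1 ((hπ x).1 hx)
    rw [hset] at hs
    obtain ⟨z, rfl⟩ := exists_dualForm_eq (n := e - 2) (by omega) (psiCoeff k e) hs
    obtain ⟨b, hb⟩ := (eagonNorthcott_exists_d_iff (sallyMatrix k e) fun _ => r).2 hr
    let a : dualBasis (e - 2 - 1) (enBasis (e - 2)) 0 → SallyRing k e := fun q => z q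
    refine ⟨(coneEquiv Ψ 0).symm (a, b), (coneZeroEquiv Ψ).injective ?_⟩
    have h := (coneEquiv Ψ 0).apply_symm_apply (a, b)
    have h1 := congrArg Prod.fst h
    have h2 := congrArg Prod.snd h
    change homotopyCofiber.fstX Ψ 1 0 _ _ = a at h1
    change homotopyCofiber.sndX Ψ 1 _ = b at h2
    rw [hd, h1, h2, hb]
    funext p
    rw [eq_enBasisZero p]
    refine Eq.trans ?_ hrs
    rw [add_comm r, ← dualForm_zeroExtend (psiCoeff k e) z, ← f_zero_apply hΨ a]
    rfl

theorem sally_cone_free (i : ℕ) : Module.Free (SallyRing k e) ((homotopyCofiber Ψ).X i) := by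
  have hF : ∀ i, Module.Free (SallyRing k e) ((eagonNorthcottDual (sallyMatrix k e)).X i) :=
    fun i => Module.Free.of_basis (basedComplexBasis _ _ (isBasedComplex_dualEntry _) i)
  have hG : ∀ i, Module.Free (SallyRing k e) ((eagonNorthcott (sallyMatrix k e)).X i) :=
    fun i => Module.Free.of_basis (basedComplexBasis _ _ (isBasedComplex_enEntry _) i)
  cases i with
  | zero => exact Module.Free.of_equiv (coneZeroEquiv Ψ).symm
  | succ i => exact Module.Free.of_equiv (coneEquiv Ψ i).symm

theorem sally_cone_finite (i : ℕ) : Module.Finite (SallyRing k e) ((homotopyCofiber Ψ).X i) := by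
  have hF : ∀ i, Module.Finite (SallyRing k e) ((eagonNorthcottDual (sallyMatrix k e)).X i) :=
    fun i => Module.Finite.of_basis (basedComplexBasis _ _ (isBasedComplex_dualEntry _) i)
  have hG : ∀ i, Module.Finite (SallyRing k e) ((eagonNorthcott (sallyMatrix k e)).X i) :=
    fun i => Module.Finite.of_basis (basedComplexBasis _ _ (isBasedComplex_enEntry _) i)
  cases i with
  | zero => exact Module.Finite.equiv (coneZeroEquiv Ψ).symm
  | succ i => exact Module.Finite.equiv (coneEquiv Ψ i).symm

theorem sally_cone_isMinimalFreeResolution (he : 4 ≤ e) (hΨ : Ψ.f 0 = sallyPsi k e) :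
    IsMinimalFreeResolution (idealOfVars (SallyIdx e) k) (homotopyCofiber Ψ)
      (ModuleCat.of (SallyRing k e) (SallyRing k e ⧸ sallyIdeal k e)) where
  free := sally_cone_free
  finite := sally_cone_finite
  exactAt i hi := by
    obtain ⟨j, rfl⟩ := Nat.exists_eq_add_of_lt hi
    rw [zero_add]
    exact sally_cone_exactAt he hΨ j
  homology_zero := sally_cone_homology_zero he hΨ
  minimal := by
    obtain ⟨Ψ₀, h₀, hm⟩ := exists_chainMap_sallyPsi k e he
    have hF := eagonNorthcottDual_imageIn (sallyMatrix k e) (sallyMatrix_mem_idealOfVars k e)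
    have hG := eagonNorthcott_imageIn (sallyMatrix k e) (sallyMatrix_mem_idealOfVars k e)
    exact cone_imageIn Ψ hF hG (ImageIn.of_f_zero_eq (fun i => basedComplex_projective i)
      (eagonNorthcott_sally_exactAt k e he) hF hG (hΨ.trans h₀.symm) hm)

theorem finrank_sally_cone_succ (j : ℕ) :
    Module.finrank (SallyRing k e) ((homotopyCofiber Ψ).X (j + 1)) =
      (dualBasis (e - 2 - 1) (enBasis (e - 2)) j).card + (enBasis (e - 2) (j + 1)).card := by
  have bF : Module.Basis _ _ ((eagonNorthcottDual (sallyMatrix k e)).X j) :=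
    basedComplexBasis _ _ (isBasedComplex_dualEntry (sallyMatrix k e)) j
  have bG : Module.Basis _ _ ((eagonNorthcott (sallyMatrix k e)).X (j + 1)) :=
    basedComplexBasis _ _ (isBasedComplex_enEntry (sallyMatrix k e)) (j + 1)
  refine (coneEquiv Ψ j).finrank_eq.trans
    ((Module.finrank_eq_card_basis (bF.prod bG)).trans ?_)
  rw [Fintype.card_sum, Fintype.card_coe, Fintype.card_coe]

end SallyCone

/-! ### The numerical form of the Betti numbers -/

/-- The rank of the cone in degree `j + 1 ≤ e - 3`. -/
theorem card_add_card_eq {e j : ℕ} (he : 4 ≤ e) (hj : j + 4 ≤ e) :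
    (((dualBasis (e - 2 - 1) (enBasis (e - 2)) j).card +
      (enBasis (e - 2) (j + 1)).card : ℕ) : ℚ) =
      (e : ℚ) * (j + 1 : ℕ) / ((e : ℚ) - (j + 1 : ℕ) - 1) * ((e - 2).choose (j + 1 + 1) : ℚ) := by
  obtain ⟨m, rfl⟩ := Nat.exists_eq_add_of_le hj
  have h0 : j + 4 + m - 2 = j + (m + 2) := by omega
  have h1 : j + 4 + m - 2 - 1 - j = m + 1 := by omega
  rw [dualBasis, if_pos (by omega), h1, h0, card_enBasis_succ, card_enBasis_succ,
    Nat.choose_symm_add.symm]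
  have c1 := Nat.choose_succ_right_eq (j + (m + 2)) j
  have c2 := Nat.choose_succ_right_eq (j + (m + 2)) (j + 1)
  rw [show j + (m + 2) - j = m + 2 by omega] at c1
  rw [show j + (m + 2) - (j + 1) = m + 1 by omega] at c2
  have c1' : (((j + (m + 2)).choose (j + 1) : ℕ) : ℚ) * (j + 1) =
    ((j + (m + 2)).choose j : ℕ) * (m + 2) := by exact_mod_cast c1
  have c2' : (((j + (m + 2)).choose (j + 2) : ℕ) : ℚ) * (j + 2) =
    ((j + (m + 2)).choose (j + 1) : ℕ) * (m + 1) := by exact_mod_cast c2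
  have hne : (m : ℚ) + 2 ≠ 0 := by positivity
  rw [show ((j + 4 + m : ℕ) : ℚ) - ((j + 1 : ℕ) : ℚ) - 1 = m + 2 by push_cast; ring,
    div_mul_eq_mul_div, eq_div_iff hne]
  push_cast
  linear_combination (-(m + 1 : ℚ)) * c1' - (j + 1 : ℚ) * c2'

theorem card_add_card_last {e : ℕ} (he : 4 ≤ e) :
    (dualBasis (e - 2 - 1) (enBasis (e - 2)) (e - 3)).card + (enBasis (e - 2) (e - 3 + 1)).card =
      1 := by
  rw [dualBasis, if_pos (by omega), show e - 2 - 1 - (e - 3) = 0 by omega,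
    enBasis_eq_empty (n := e - 2) (i := e - 3 + 1) (by omega) (by omega)]
  rfl


end

theorem mainTheorem2 {k : Type u} [Field k] (e : ℕ) (he : 4 ≤ e) :
    (∃ Ψ : eagonNorthcottDual (sallyMatrix k e) ⟶ eagonNorthcott (sallyMatrix k e),
      Ψ.f 0 = sallyPsi k e) ∧
    (∀ Ψ : eagonNorthcottDual (sallyMatrix k e) ⟶ eagonNorthcott (sallyMatrix k e),
      Ψ.f 0 = sallyPsi k e →
        IsMinimalFreeResolution (MvPolynomial.idealOfVars (SallyIdx e) k)
          (HomologicalComplex.homotopyCofiber Ψ)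
          (ModuleCat.of (SallyRing k e) (SallyRing k e ⧸ sallyIdeal k e))) ∧
    (∀ t : ℕ, 1 ≤ t → t ≤ e - 3 →
      (bettiNumber k (SallyIdx e)
          (ModuleCat.of (SallyRing k e) (SallyRing k e ⧸ sallyIdeal k e)) t : ℚ) =
        (e : ℚ) * t / ((e : ℚ) - t - 1) * (Nat.choose (e - 2) (t + 1) : ℚ)) ∧
    bettiNumber k (SallyIdx e)
      (ModuleCat.of (SallyRing k e) (SallyRing k e ⧸ sallyIdeal k e)) (e - 2) = 1 := by
  obtain ⟨Ψ, hΨ, -⟩ := exists_chainMap_sallyPsi k e he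
  have hb : ∀ j, bettiNumber k (SallyIdx e)
      (ModuleCat.of (SallyRing k e) (SallyRing k e ⧸ sallyIdeal k e)) (j + 1) =
        (dualBasis (e - 2 - 1) (enBasis (e - 2)) j).card + (enBasis (e - 2) (j + 1)).card :=
    fun j => ((sally_cone_isMinimalFreeResolution he hΨ).bettiNumber_eq (j + 1)).trans
      (finrank_sally_cone_succ j)
  refine ⟨⟨Ψ, hΨ⟩, fun Ψ' hΨ' => sally_cone_isMinimalFreeResolution he hΨ', fun t ht hte => ?_, ?_⟩
  · obtain ⟨j, rfl⟩ := Nat.exists_eq_add_of_le' ht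
    rw [hb j]
    exact card_add_card_eq he (by omega)
  · rw [show e - 2 = e - 3 + 1 by omega, hb (e - 3)]
    exact card_add_card_last he
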